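/- **Proposition.** Let $\mathcal C=[0,1]^3\subset\mathbb R^3$ be the unit cube with its six facets, and let $\Gamma$ be its right-angled Coxeter group, acting on $\mathbb R^3$ by the reflections in the facets of $\mathcal C$. A (proper) colouring of $\mathcal C$ in an $\mathbb F_2$-vector space $W$ is a map $\lambda$ from the facets to $W$ whose image generates $W$, and such that the colours of facets with a common point are linearly independent; its rank is $\dim W$. It induces a homomorphism $\lambda:\Gamma\to W$ and a closed flat manifold $M_\lambda=\mathbb R^3/\ker\lambda$; the colouring is orientable if $M_\lambda$ is, i.e. if $\ker\lambda$ preserves the orientation of $\mathbb R^3$. Colourings $\lambda$ in $W$ and $\mu$ in $W'$ are DJ-equivalent if $\lambda=m\circ\mu\circ s$ for a symmetry $s$ of the cube and a linear isomorphism $m:W'\to W$. The length spectrum of $\lambda$ is the set of the lengths $\|v\|$ of the nonzero vectors $v$ for which the translation by $v$ lies in $\ker\lambda$ (the translations in $\ker \lambda$ form its maximal toric sublattice). 1. The orientable colourings of $\mathcal C$ of rank $3,4,5,6$ form exactly $2,6,4,1$ DJ-equivalence classes respectively, and there are none of any other rank. 2. Two orientable colourings $\lambda,\mu$ are DJ-equivalent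 if and only if $M_\lambda$ and $M_\mu$ are isometric. In particular, the manifolds from distinct classes are pairwise non-isometric. 3. The volume of $M_\lambda$ is $2^{k}$, where $k$ is the rank of $\lambda$. If two orientable colourings $\lambda,\mu$ are not DJ-equivalent, then $M_\lambda$ and $M_\mu$ are not homeomorphic, or they have different volumes (equivalently, different ranks), or $\lambda$ and $\mu$ have different length spectra. -/

import Mathlib

open scoped InnerProductSpace

noncomputable section

namespace RightAngledCube

/-- Euclidean three-space. -/
abbrev Space : Type := EuclideanSpace ℝ (Fin 3)

/-- Isometries of a Euclidean space act on its points. -/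
instance isometryAction : MulAction (Space ≃ᵃⁱ[ℝ] Space) Space where
  smul g x := g x
  one_smul _ := rfl
  mul_smul _ _ _ := rfl

theorem smul_eq_apply (g : Space ≃ᵃⁱ[ℝ] Space) (x : Space) : g • x = g x := rfl

/-- The unit cube `[0,1]³`. -/
def cube : Set Space := {x | ∀ i, x i ∈ Set.Icc (0 : ℝ) 1}

/-- The six facets of the cube are labelled by `(i, b)`, where `i` is the coordinate that is
constant on the facet, and `b` tells whether its value is `0` or `1`. -/
abbrev Facet : Type := Fin 3 × Bool

/-- The constant value of the coordinate `f.1` on the facet `f`. -/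
def Facet.level (f : Facet) : ℝ := if f.2 then 1 else 0

/-- The points of the facet with a given label. -/
def Facet.points (f : Facet) : Set Space := {x | x ∈ cube ∧ x f.1 = f.level}

/-- The affine plane that contains a facet. -/
def Facet.plane (f : Facet) : AffineSubspace ℝ Space :=
  AffineSubspace.mk' (EuclideanSpace.single f.1 f.level)
    (ℝ ∙ (EuclideanSpace.single f.1 (1 : ℝ) : Space))ᗮ

instance (f : Facet) : Nonempty f.plane :=
  ⟨⟨_, AffineSubspace.self_mem_mk' _ _⟩⟩

/-- The orthogonal reflection in the plane of a facet. -/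
def Facet.reflection (f : Facet) : Space ≃ᵃⁱ[ℝ] Space :=
  EuclideanGeometry.reflection f.plane

theorem Facet.reflection_apply (f : Facet) (x : Space) (j : Fin 3) :
    f.reflection x j = if j = f.1 then 2 * f.level - x j else x j := by
  have aux : ∀ (K K' : Submodule ℝ Space) (_ : K = K') (v : Space),
      K.reflection v = K'.reflection v := by
    rintro K _ rfl v
    rfl
  rw [Facet.reflection, EuclideanGeometry.reflection_apply_of_mem f.plane x
    (AffineSubspace.self_mem_mk' (EuclideanSpace.single f.1 f.level)
      (ℝ ∙ (EuclideanSpace.single f.1 (1 : ℝ) : Space))ᗮ),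
    aux f.plane.direction _ (AffineSubspace.direction_mk' _ _), Submodule.reflection_orthogonal_apply,
    Submodule.reflection_singleton_apply]
  by_cases h : j = f.1
  · subst h
    simp [EuclideanSpace.inner_single_left]
    ring
  · simp [EuclideanSpace.inner_single_left, h]

/-- The Coxeter matrix of the cube: the reflections in two facets that meet commute, and there is
no relation between the reflections in two parallel facets (encoded by `0`). -/
def coxeterMatrix : CoxeterMatrix Facet where
  M := Matrix.of fun f g => if f = g then 1 else if f.1 = g.1 then 0 else 2
  isSymm := by
    ext f g
    simp only [Matrix.transpose_apply, Matrix.of_apply, eq_comm]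
  diagonal f := by simp
  off_diagonal f g h := by
    simp only [Matrix.of_apply, if_neg h]
    split <;> simp

/-- The right-angled Coxeter group `Γ` of the cube. -/
abbrev CoxeterGroup : Type := coxeterMatrix.Group

theorem isLiftable_reflection : coxeterMatrix.IsLiftable Facet.reflection := by
  intro f g
  by_cases h : f = g
  · subst h
    rw [coxeterMatrix.diagonal, pow_one]
    ext x j
    change f.reflection (f.reflection x) j = x j
    simp only [Facet.reflection_apply]
    split_ifs <;> ring
  · by_cases h' : f.1 = g.1
    · have : coxeterMatrix.M f g = 0 := by simp [coxeterMatrix, h, h']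
      rw [this, pow_zero]
    · have : coxeterMatrix.M f g = 2 := by simp [coxeterMatrix, h, h']
      rw [this, pow_two]
      ext x j
      change f.reflection (g.reflection (f.reflection (g.reflection x))) j = x j
      simp only [Facet.reflection_apply]
      split_ifs with h1 h2
      · exact absurd (h1.symm.trans h2) h'
      all_goals ring

/-- The action of the Coxeter group on Euclidean space, where generators act by the reflections in
the facets of the cube. -/
def geometricRep : CoxeterGroup →* (Space ≃ᵃⁱ[ℝ] Space) :=
  coxeterMatrix.toCoxeterSystem.lift ⟨Facet.reflection, isLiftable_reflection⟩

/-- The group `Sym(C)` of symmetries of the cube, as a set of permutations of the facets: those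
that are induced by an isometry of space that maps the cube to itself. -/
def IsSymmetry (s : Equiv.Perm Facet) : Prop :=
  ∃ φ : Space ≃ᵃⁱ[ℝ] Space, φ '' cube = cube ∧ ∀ f : Facet, φ '' f.points = (s f).points

/-- A proper colouring of the cube in an `𝔽₂`-vector space `W`: the colours generate `W`, and the
colours of facets which have a common point (the simplices of the dual polytope) are linearly
independent. -/
@[ext]
structure Colouring (W : Type*) [AddCommGroup W] [Module (ZMod 2) W] where
  /-- The colour of a facet. -/
  colour : Facet → W
  span_eq_top : Submodule.span (ZMod 2) (Set.range colour) = ⊤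
  proper : ∀ S : Set Facet, (⋂ f ∈ S, f.points).Nonempty → LinearIndepOn (ZMod 2) colour S

section

variable {W W' : Type*} [AddCommGroup W] [Module (ZMod 2) W] [AddCommGroup W']
  [Module (ZMod 2) W']

theorem Colouring.isLiftable (c : Colouring W) :
    coxeterMatrix.IsLiftable (fun f => Multiplicative.ofAdd (c.colour f)) := by
  have hd : ∀ w : Multiplicative W, w * w = 1 := fun w =>
    ZModModule.add_self (Multiplicative.toAdd w)
  intro f g
  by_cases h : f = g
  · subst h
    rw [coxeterMatrix.diagonal, pow_one, hd]
  · by_cases h' : f.1 = g.1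
    · have : coxeterMatrix.M f g = 0 := by simp [coxeterMatrix, h, h']
      rw [this, pow_zero]
    · have : coxeterMatrix.M f g = 2 := by simp [coxeterMatrix, h, h']
      rw [this, pow_two, hd]

/-- The homomorphism `Γ → W` defined by a colouring. -/
def Colouring.hom (c : Colouring W) : CoxeterGroup →* Multiplicative W :=
  coxeterMatrix.toCoxeterSystem.lift ⟨_, c.isLiftable⟩

/-- The kernel of a colouring `Γ → W`, as a group of isometries of Euclidean space. -/
def Colouring.kernelGroup (c : Colouring W) : Subgroup (Space ≃ᵃⁱ[ℝ] Space) :=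
  c.hom.ker.map geometricRep

/-- The manifold `ℝ³ / ker λ` of a colouring `λ`, with the quotient topology. -/
abbrev Colouring.Manifold (c : Colouring W) : Type :=
  Quotient (MulAction.orbitRel c.kernelGroup Space)

/-- The distance of the flat Riemannian metric on the manifold of a colouring: the distance of two
orbits in Euclidean space. -/
def Colouring.quotientDist (c : Colouring W) (p q : c.Manifold) : ℝ :=
  sInf {d : ℝ | ∃ x y : Space,
    Quotient.mk (MulAction.orbitRel c.kernelGroup Space) x = p ∧
    Quotient.mk (MulAction.orbitRel c.kernelGroup Space) y = q ∧ d = dist x y}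

/-- The manifolds of two colourings are isometric. -/
def Colouring.Isometric (c : Colouring W) (c' : Colouring W') : Prop :=
  ∃ e : c.Manifold ≃ c'.Manifold, ∀ p q, c'.quotientDist (e p) (e q) = c.quotientDist p q

/-- The manifolds of two colourings are homeomorphic. -/
def Colouring.Homeomorphic (c : Colouring W) (c' : Colouring W') : Prop :=
  Nonempty (c.Manifold ≃ₜ c'.Manifold)

/-- The manifold `ℝ³ / ker λ` of the colouring is orientable: each element of `ker λ` preserves the
orientation of `ℝ³`. -/
def Colouring.Orientable (c : Colouring W) : Prop :=
  ∀ g ∈ c.kernelGroup, 0 < LinearMap.det (g.linearIsometryEquiv.toLinearEquiv : Space →ₗ[ℝ] Space)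

/-- The volume of the manifold of a colouring, that is, of a fundamental domain of its group. -/
def Colouring.volume (c : Colouring W) : ENNReal :=
  MeasureTheory.covolume c.kernelGroup Space MeasureTheory.volume

/-- The maximal toric sublattice of `ker λ`: the translations in `ker λ`, given by their
translation vectors. -/
def Colouring.toricLattice (c : Colouring W) : Set Space :=
  {v | AffineIsometryEquiv.constVAdd ℝ Space v ∈ c.kernelGroup}

/-- The length spectrum of the flat torus `ℝ³ / L`, where `L` is the maximal toric sublattice: the
set of the lengths of its closed geodesics. -/
def Colouring.lengthSpectrum (c : Colouring W) : Set ℝ :=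
  {l | ∃ v ∈ c.toricLattice, v ≠ 0 ∧ ‖v‖ = l}

/-- DJ-equivalence of colourings: `λ = m ∘ μ ∘ s` with an invertible linear map `m` and a symmetry
`s` of the cube. -/
def Colouring.DJEquiv (c : Colouring W) (c' : Colouring W') : Prop :=
  ∃ s : Equiv.Perm Facet, IsSymmetry s ∧
    ∃ m : W' ≃ₗ[ZMod 2] W, ∀ f, c.colour f = m (c'.colour (s f))

end

theorem IsSymmetry.refl : IsSymmetry (Equiv.refl Facet) :=
  ⟨AffineIsometryEquiv.refl ℝ Space, by simp, by simp⟩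

theorem IsSymmetry.symm {s : Equiv.Perm Facet} (h : IsSymmetry s) : IsSymmetry s.symm := by
  obtain ⟨φ, h1, h2⟩ := h
  have key : ∀ A B : Set Space, φ '' A = B → φ.symm '' B = A := by
    rintro A _ rfl
    simp [Set.image_image]
  exact ⟨φ.symm, key _ _ h1, fun f => key _ _ (by rw [h2, Equiv.apply_symm_apply])⟩

theorem IsSymmetry.trans {s t : Equiv.Perm Facet} (h : IsSymmetry s) (h' : IsSymmetry t) :
    IsSymmetry (s.trans t) := by
  obtain ⟨φ, h1, h2⟩ := h
  obtain ⟨ψ, h3, h4⟩ := h'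
  refine ⟨φ.trans ψ, ?_, fun f => ?_⟩
  · rw [AffineIsometryEquiv.coe_trans, Set.image_comp, h1, h3]
  · rw [AffineIsometryEquiv.coe_trans, Set.image_comp, h2, h4, Equiv.trans_apply]

/-- DJ-equivalence as an equivalence relation on the orientable colourings in `W`. -/
def djSetoid (W : Type*) [AddCommGroup W] [Module (ZMod 2) W] :
    Setoid {c : Colouring W // c.Orientable} where
  r c c' := c.1.DJEquiv c'.1
  iseqv :=
    { refl := fun c => ⟨Equiv.refl _, IsSymmetry.refl, LinearEquiv.refl _ _, fun _ => rfl⟩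
      symm := by
        rintro c c' ⟨s, hs, m, h⟩
        exact ⟨s.symm, hs.symm, m.symm, fun f => by simp [h]⟩
      trans := by
        rintro c c' c'' ⟨s, hs, m, h⟩ ⟨s', hs', m', h'⟩
        exact ⟨s.trans s', hs.trans hs', m'.trans m, fun f => by simp [h, h']⟩ }

/-- The DJ-equivalence classes of the orientable colourings in `W`. -/
def DJClass (W : Type*) [AddCommGroup W] [Module (ZMod 2) W] : Type _ :=
  Quotient (djSetoid W)

end RightAngledCube

end

/-!
The proof reduces the geometry of a colouring `λ` to a binary code, and classifies the codes.

The code of `λ` is the space `K ⊆ 𝔽₂⁶` of the linear relations between the colours of the six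
facets. It determines `λ` up to linear isomorphisms, so DJ-equivalence of colourings is equivalence
of codes under the symmetries of the cube, which are the permutations of the facets that preserve
parallelism (`Colouring.djEquiv_iff`). Properness of `λ` says that each nonzero vector of `K`
contains a pair of parallel facets (`Colouring.isProperCode`), orientability that each vector has an
even number of nonzero coordinates (`Colouring.orientable_iff`), and the rank is `6 - dim K`.

The isometries by which the Coxeter group acts are the maps `xᵢ ↦ ± xᵢ + 2 nᵢ`. Such a map lies in
`ker λ` if and only if the vector in `𝔽₂⁶` that counts the reflections of which it is composed lies
in `K` (`Colouring.mem_kernelGroup`). Hence the translation by `2 n` is in `ker λ` if and only if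
the vector with the coordinates `nᵢ` mod `2` on both facets of the axis `i` is in `K`. So `K` has
such a vector that is nonzero on `w ≤ 3` axes if and only if `2 √w` is in the length spectrum
(`Colouring.mem_lengthSpectrum_iff`); and `ker λ` is commutative if and only if all vectors of `K`
are of this translational kind (`Colouring.commute_iff`). Moreover, nontrivial elements of `ker λ`
displace each point by at least `2` (`Colouring.two_le_dist`), so `ℝ³ → M_λ` is a covering.

There are thirteen classes of even proper codes. They are found by adjoining one vector at a time to
the codes already found (`normalForms_step`), and they are told apart by the order of `K`, the
weights `w` of its translational vectors, and whether all of its vectors are translational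
(`normalForms_injective`). These invariants are determined by the volume `2 ^ k`
(`Colouring.volume_eq`, by a fundamental domain that consists of one cube for each colour), by the
length spectrum, and by the homeomorphism type of `M_λ`, as `ker λ` is the group of deck
transformations of its universal cover. Finally, an isometry `M_λ → M_μ` lifts to an isometry of
`ℝ³` that conjugates `ker λ` to `ker μ`, and so preserves all of these invariants, while conversely
a DJ-equivalence provides such an isometry.
-/

open scoped InnerProductSpace Topology

noncomputable section

namespace RightAngledCube

/-! ### Binary codes on the facets -/

/-- The vectors of the code of a colouring are the relations between its colours; so this is the
kernel of the linear map `𝔽₂⁶ → W` that extends the colouring. -/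
def Colouring.code {W : Type*} [AddCommGroup W] [Module (ZMod 2) W] (c : Colouring W) :
    Submodule (ZMod 2) (Facet → ZMod 2) :=
  LinearMap.ker (Fintype.linearCombination (ZMod 2) c.colour)

/-- Each nonzero vector of a proper code contains a pair of parallel facets. -/
def IsProperCode (K : Submodule (ZMod 2) (Facet → ZMod 2)) : Prop :=
  ∀ v ∈ K, v ≠ 0 → ∃ i, v (i, false) = 1 ∧ v (i, true) = 1

/-- Each vector of an even code has an even number of nonzero coordinates. -/
def IsEvenCode (K : Submodule (ZMod 2) (Facet → ZMod 2)) : Prop :=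
  ∀ v ∈ K, ∑ f, v f = 0

/-- A permutation of the facets that maps parallel facets to parallel facets. -/
def PreservesParallel (s : Equiv.Perm Facet) : Prop :=
  ∀ f g : Facet, f.1 = g.1 → (s f).1 = (s g).1

theorem PreservesParallel.trans {s t : Equiv.Perm Facet} (hs : PreservesParallel s)
    (ht : PreservesParallel t) : PreservesParallel (s.trans t) :=
  fun _ _ h => ht _ _ (hs _ _ h)

theorem eq_or_eq_not_of_fst_eq {f g : Facet} (h : f.1 = g.1) : f = g ∨ f = (g.1, !g.2) := by
  obtain ⟨i, b⟩ := f
  obtain ⟨j, d⟩ := g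
  obtain rfl : i = j := h
  cases b <;> cases d <;> simp

/-- Opposite facets go to opposite facets. -/
theorem PreservesParallel.apply_not {s : Equiv.Perm Facet} (hs : PreservesParallel s) (i : Fin 3)
    (b : Bool) : s (i, !b) = ((s (i, b)).1, !(s (i, b)).2) := by
  rcases eq_or_eq_not_of_fst_eq (hs (i, !b) (i, b) rfl) with h | h
  · simpa using s.injective h
  · exact h

theorem PreservesParallel.symm {s : Equiv.Perm Facet} (hs : PreservesParallel s) :
    PreservesParallel s.symm := by
  intro f g h
  rcases eq_or_eq_not_of_fst_eq h with rfl | rfl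
  · rfl
  · have : s.symm (g.1, !g.2) = ((s.symm g).1, !(s.symm g).2) := by
      rw [Equiv.symm_apply_eq, hs.apply_not]
      simp
    rw [this]

/-- The vector on the facets whose coordinates are the binary digits of a natural number: the facet
`(i, b)` belongs to the digit `2 * i + b`. -/
def digits (n : ℕ) : Facet → ZMod 2 :=
  fun f => if n.testBit (2 * f.1.val + f.2.toNat) then 1 else 0

theorem digits_xor (m n : ℕ) : digits (m ^^^ n) = digits m + digits n := by
  funext f
  simp only [digits, Nat.testBit_xor, Pi.add_apply]
  cases m.testBit (2 * f.1.val + f.2.toNat) <;> cases n.testBit (2 * f.1.val + f.2.toNat) <;> decide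

theorem digits_zero : digits 0 = 0 := by
  funext f
  simp [digits]

/-- The facet of a binary digit. -/
def facetOfDigit (k : Fin 6) : Facet := (⟨k.val / 2, by omega⟩, k.val.testBit 0)

theorem digits_ofBits (p : Fin 6 → Bool) (f : Facet) (k : Fin 6) (hk : facetOfDigit k = f) :
    digits (Nat.ofBits p) f = if p k then 1 else 0 := by
  subst hk
  have h : 2 * (k.val / 2) + (k.val.testBit 0).toNat = k.val := by
    revert k; decide
  simp only [digits, facetOfDigit, h]
  rw [Nat.testBit_ofBits_lt _ _ k.isLt]

theorem facetOfDigit_surjective : Function.Surjective facetOfDigit := by decide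

theorem exists_digits_eq (v : Facet → ZMod 2) : ∃ n < 64, digits n = v := by
  refine ⟨Nat.ofBits fun k : Fin 6 => decide (v (facetOfDigit k) = 1), Nat.ofBits_lt_two_pow _, ?_⟩
  funext f
  obtain ⟨k, hk⟩ := facetOfDigit_surjective f
  rw [digits_ofBits _ f k hk, hk]
  generalize v f = a
  revert a
  decide

theorem digits_injOn {m n : ℕ} (hm : m < 64) (hn : n < 64) (h : digits m = digits n) : m = n := by
  apply Nat.eq_of_testBit_eq
  intro k
  by_cases hk : k < 6
  · have := congrFun h (facetOfDigit ⟨k, hk⟩)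
    have e : 2 * (k / 2) + (k.testBit 0).toNat = k := by
      interval_cases k <;> decide
    simp only [digits, facetOfDigit, e] at this
    cases h1 : m.testBit k <;> cases h2 : n.testBit k <;> simp_all
  · have : 64 ≤ 2 ^ k := Nat.pow_le_pow_right (n := 2) (by norm_num) (show 6 ≤ k by omega)
    rw [Nat.testBit_lt_two_pow (by omega), Nat.testBit_lt_two_pow (by omega)]

/-- The number whose digits are those of `n`, rearranged by a permutation of the facets. -/
def permDigits (s : Facet → Facet) (n : ℕ) : ℕ :=
  Nat.ofBits fun k : Fin 6 =>
    n.testBit (2 * (s (facetOfDigit k)).1.val + (s (facetOfDigit k)).2.toNat)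

theorem digits_permDigits (s : Facet → Facet) (n : ℕ) :
    digits (permDigits s n) = digits n ∘ s := by
  funext f
  obtain ⟨k, hk⟩ := facetOfDigit_surjective f
  rw [permDigits, digits_ofBits _ f k hk, hk]
  rfl

/-- The symmetry of the cube that permutes the axes by `i ↦ r + i` or `i ↦ r - i`, followed by
exchanging the two ends of the axes according to `t`. Each permutation of three axes has this
form. -/
def axisSymmetry (d : Bool) (r : Fin 3) (t : Fin 3 → Bool) : Equiv.Perm Facet where
  toFun f := (if d then r - f.1 else r + f.1, xor f.2 (t f.1))
  invFun f := ((if d then r - f.1 else f.1 - r), xor f.2 (t (if d then r - f.1 else f.1 - r)))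
  left_inv f := by cases d <;> simp
  right_inv f := by cases d <;> simp

theorem preservesParallel_axisSymmetry (d : Bool) (r : Fin 3) (t : Fin 3 → Bool) :
    PreservesParallel (axisSymmetry d r t) := by
  intro f g h
  simp [axisSymmetry, h]

/-- The vector `digits n` has an even number of nonzero coordinates, and contains a pair of parallel
facets. These are the conditions on the nonzero vectors of an even proper code. -/
def admissible (n : ℕ) : Bool :=
  (((List.range 6).countP n.testBit) % 2 == 0) &&
    (List.range 3).any fun i => n.testBit (2 * i) && n.testBit (2 * i + 1)

/-- The normal forms of the even proper codes, one for each equivalence class. Each is given by the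
numbers whose digits form its vectors. On each axis, the binary digits of a number at `2 * i` and
`2 * i + 1` read `00`, `01`, `10` or `11`, so that `3`, `12`, `48` are the three pairs of parallel
facets. -/
def normalForms : List (List ℕ) :=
  [[0], [3, 0], [15, 0], [63, 0], [23, 0], [15, 12, 3, 0], [63, 48, 15, 0], [60, 51, 15, 0],
    [27, 23, 12, 0], [43, 23, 60, 0], [58, 45, 23, 0], [63, 60, 51, 48, 15, 12, 3, 0],
    [43, 39, 27, 23, 60, 48, 12, 0]]

/-- If a code contains a normal form `L` and a further vector `n`, then the code that they generate
either has a vector that is not admissible, or it is the image of a larger normal form `L'` under a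
symmetry. -/
theorem normalForms_step : ∀ L ∈ normalForms, ∀ n ∈ List.range 64,
    (n ∈ L ∨ ∃ m ∈ L, admissible (n ^^^ m) = false) ∨
    ∃ L' ∈ normalForms, L'.length = L.length + L.length ∧
      ∃ d ∈ [false, true], ∃ r ∈ List.finRange 3, ∃ t ∈ List.range 8,
      ∀ m ∈ L', permDigits (axisSymmetry d r fun i => t.testBit i) m ∈ L ∨
        n ^^^ permDigits (axisSymmetry d r fun i => t.testBit i) m ∈ L := by
  decide +kernel

/-! ### Equivalence and normal forms of codes -/

/-- Two codes are equivalent if a permutation of the facets that preserves parallelism maps one to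
the other. -/
def CodeEquiv (K K' : Submodule (ZMod 2) (Facet → ZMod 2)) : Prop :=
  ∃ s : Equiv.Perm Facet, PreservesParallel s ∧ ∀ v : Facet → ZMod 2, v ∘ s ∈ K ↔ v ∈ K'

theorem CodeEquiv.symm {K K' : Submodule (ZMod 2) (Facet → ZMod 2)} (h : CodeEquiv K K') :
    CodeEquiv K' K := by
  obtain ⟨s, hs, h⟩ := h
  refine ⟨s.symm, hs.symm, fun v => ?_⟩
  rw [← h, Function.comp_assoc, Equiv.symm_comp_self, Function.comp_id]

theorem CodeEquiv.trans {K K' K'' : Submodule (ZMod 2) (Facet → ZMod 2)} (h : CodeEquiv K K')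
    (h' : CodeEquiv K' K'') : CodeEquiv K K'' := by
  obtain ⟨s, hs, h⟩ := h
  obtain ⟨s', hs', h'⟩ := h'
  refine ⟨s.trans s', hs.trans hs', fun v => ?_⟩
  rw [← h', ← h]
  rfl

theorem normalForms_closed : ∀ L ∈ normalForms,
    0 ∈ L ∧ ∀ m ∈ L, m < 64 ∧ (m = 0 ∨ admissible m = true) ∧ ∀ n ∈ L, m ^^^ n ∈ L := by
  decide +kernel

theorem admissible_iff : ∀ n ∈ List.range 64, admissible n = true ↔
    ∑ f, digits n f = 0 ∧ ∃ i, digits n (i, false) = 1 ∧ digits n (i, true) = 1 := by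
  decide +kernel

/-- The code in normal form that is given by a list of numbers. -/
def normalCode (L : {L // L ∈ normalForms}) : Submodule (ZMod 2) (Facet → ZMod 2) where
  carrier := {v | ∃ n ∈ L.1, digits n = v}
  zero_mem' := ⟨0, (normalForms_closed _ L.2).1, digits_zero⟩
  add_mem' := by
    rintro _ _ ⟨m, hm, rfl⟩ ⟨n, hn, rfl⟩
    exact ⟨_, ((normalForms_closed _ L.2).2 m hm).2.2 n hn, digits_xor m n⟩
  smul_mem' := by
    intro a
    have ha : a = 0 ∨ a = 1 := by revert a; decide
    rintro _ ⟨m, hm, rfl⟩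
    rcases ha with rfl | rfl
    · exact ⟨0, (normalForms_closed _ L.2).1, by rw [zero_smul, digits_zero]⟩
    · exact ⟨m, hm, by rw [one_smul]⟩

theorem mem_normalCode {L : {L // L ∈ normalForms}} {v : Facet → ZMod 2} :
    v ∈ normalCode L ↔ ∃ n ∈ L.1, digits n = v := Iff.rfl

theorem isEvenCode_normalCode (L : {L // L ∈ normalForms}) : IsEvenCode (normalCode L) := by
  rintro _ ⟨n, hn, rfl⟩
  obtain ⟨h1, h2, -⟩ := (normalForms_closed _ L.2).2 n hn
  rcases h2 with rfl | h2
  · simp [digits_zero]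
  · exact ((admissible_iff n (List.mem_range.2 h1)).1 h2).1

theorem isProperCode_normalCode (L : {L // L ∈ normalForms}) : IsProperCode (normalCode L) := by
  rintro _ ⟨n, hn, rfl⟩ h0
  obtain ⟨h1, h2, -⟩ := (normalForms_closed _ L.2).2 n hn
  rcases h2 with rfl | h2
  · exact absurd digits_zero h0
  · exact ((admissible_iff n (List.mem_range.2 h1)).1 h2).2

theorem card_normalCode (L : {L // L ∈ normalForms}) : Nat.card (normalCode L) = L.1.length := by
  have hnd : ∀ L ∈ normalForms, L.Nodup := by decide +kernel
  have : ((normalCode L : Set (Facet → ZMod 2))) = digits '' {n | n ∈ L.1} := by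
    ext v
    simp [mem_normalCode]
  rw [← SetLike.coe_sort_coe, this, Nat.card_image_of_injOn, Nat.card_coe_set_eq]
  · rw [← List.coe_toFinset, Set.ncard_coe_finset, List.toFinset_card_of_nodup (hnd _ L.2)]
  · intro m hm n hn h
    exact digits_injOn ((normalForms_closed _ L.2).2 m hm).1
      ((normalForms_closed _ L.2).2 n hn).1 h

/-- An even proper code that contains, up to symmetry, a normal form is equivalent to a normal form:
as long as it is larger than the one found so far, `normalForms_step` gives a larger one. -/
theorem exists_codeEquiv_of_subset {K : Submodule (ZMod 2) (Facet → ZMod 2)} (hp : IsProperCode K)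
    (he : IsEvenCode K) (L : {L // L ∈ normalForms}) (s : Equiv.Perm Facet)
    (hs : PreservesParallel s) (h : ∀ m ∈ L.1, digits m ∘ s ∈ K) :
    ∃ L, CodeEquiv K (normalCode L) := by
  by_cases hL : ∀ v : Facet → ZMod 2, v ∘ s ∈ K → v ∈ normalCode L
  · refine ⟨L, s, hs, fun v => ⟨hL v, ?_⟩⟩
    rintro ⟨m, hm, rfl⟩
    exact h m hm
  push Not at hL
  obtain ⟨v, hv, hvL⟩ := hL
  obtain ⟨n, hn, rfl⟩ := exists_digits_eq v
  have hmem : ∀ m ∈ L.1, digits (n ^^^ m) ∘ s ∈ K := fun m hm => by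
    rw [digits_xor]
    exact K.add_mem hv (h m hm)
  have hadm : ∀ m ∈ L.1, admissible (n ^^^ m) = true := by
    intro m hm
    have hlt : n ^^^ m < 64 :=
      Nat.xor_lt_two_pow (n := 6) hn ((normalForms_closed _ L.2).2 m hm).1
    refine (admissible_iff _ (List.mem_range.2 hlt)).2 ⟨?_, ?_⟩
    · rw [← he _ (hmem m hm)]
      exact (Equiv.sum_comp s _).symm
    · have hne : digits (n ^^^ m) ∘ s ≠ 0 := by
        intro h0
        refine hvL ⟨m, hm, ?_⟩
        have h1 : digits n + digits m = 0 := by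
          rw [← digits_xor]
          funext f
          simpa using congrFun h0 (s.symm f)
        rw [add_eq_zero_iff_eq_neg, ZModModule.neg_eq_self] at h1
        exact h1.symm
      obtain ⟨i, h1, h2⟩ := hp _ (hmem m hm) hne
      -- the symmetry sends the pair of parallel facets on the axis `i` to such a pair
      have h3 := hs.apply_not i false
      simp only [Bool.not_false] at h3
      rw [Function.comp_apply] at h1 h2
      rw [h3] at h2
      refine ⟨(s (i, false)).1, ?_⟩
      generalize s (i, false) = g at h1 h2
      obtain ⟨j, b⟩ := g
      cases b
      · exact ⟨h1, h2⟩
      · exact ⟨h2, h1⟩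
  rcases normalForms_step L.1 L.2 n (List.mem_range.2 hn) with
    (h' | ⟨m, hm, h'⟩) | ⟨L', hL', hlen, d, -, r, -, t, -, h'⟩
  · exact absurd ⟨n, h', rfl⟩ hvL
  · rw [hadm m hm] at h'
    exact absurd h' (by decide)
  · have hlen0 : 0 < L.1.length := List.length_pos_of_mem (normalForms_closed _ L.2).1
    have hle : L'.length ≤ 8 := by
      have : ∀ L ∈ normalForms, L.length ≤ 8 := by decide
      exact this _ hL'
    refine exists_codeEquiv_of_subset hp he ⟨L', hL'⟩
      (s.trans (axisSymmetry d r fun i => t.testBit i))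
      (hs.trans (preservesParallel_axisSymmetry _ _ _)) fun m hm => ?_
    rw [Equiv.coe_trans, ← Function.comp_assoc, ← digits_permDigits]
    rcases h' m hm with h' | h'
    · exact h _ h'
    · have := hmem _ h'
      rwa [← Nat.xor_assoc, Nat.xor_self, Nat.zero_xor] at this
termination_by 8 - L.1.length

/-- Each even proper code is equivalent to one in normal form. -/
theorem exists_codeEquiv_normalCode {K : Submodule (ZMod 2) (Facet → ZMod 2)}
    (hp : IsProperCode K) (he : IsEvenCode K) : ∃ L, CodeEquiv K (normalCode L) :=
  exists_codeEquiv_of_subset hp he ⟨[0], by decide⟩ (Equiv.refl _) (fun _ _ h => h) (by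
    simp [digits_zero])

/-! ### Invariants of codes -/

/-- The vectors that have equal coordinates on parallel facets: these are the classes of the
elements of `Γ` that act by translations. -/
def IsTranslational (v : Facet → ZMod 2) : Prop := ∀ i, v (i, false) = v (i, true)

instance (v : Facet → ZMod 2) : Decidable (IsTranslational v) :=
  inferInstanceAs (Decidable (∀ _, _))

/-- The code contains a translational vector that is nonzero on `w` of the axes. -/
def HasWeight (K : Submodule (ZMod 2) (Facet → ZMod 2)) (w : ℕ) : Prop :=
  ∃ v ∈ K, IsTranslational v ∧ hammingNorm v = 2 * w

theorem isTranslational_comp {s : Equiv.Perm Facet} (hs : PreservesParallel s)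
    {v : Facet → ZMod 2} (hv : IsTranslational v) : IsTranslational (v ∘ s) := by
  intro i
  have h := hs.apply_not i false
  simp only [Bool.not_false] at h
  rw [Function.comp_apply, Function.comp_apply, h]
  generalize s (i, false) = g
  obtain ⟨j, b⟩ := g
  cases b
  · exact hv j
  · exact (hv j).symm

theorem hammingNorm_comp (s : Equiv.Perm Facet) (v : Facet → ZMod 2) :
    hammingNorm (v ∘ s) = hammingNorm v := by
  unfold hammingNorm
  exact Finset.card_equiv s (by simp)

theorem CodeEquiv.hasWeight {K K' : Submodule (ZMod 2) (Facet → ZMod 2)} (h : CodeEquiv K K')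
    {w : ℕ} (hw : HasWeight K' w) : HasWeight K w := by
  obtain ⟨s, hs, h⟩ := h
  obtain ⟨v, hv, h1, h2⟩ := hw
  exact ⟨v ∘ s, (h v).2 hv, isTranslational_comp hs h1, by rw [hammingNorm_comp, h2]⟩

theorem CodeEquiv.hasWeight_iff {K K' : Submodule (ZMod 2) (Facet → ZMod 2)}
    (h : CodeEquiv K K') (w : ℕ) : HasWeight K w ↔ HasWeight K' w :=
  ⟨h.symm.hasWeight, h.hasWeight⟩

theorem CodeEquiv.translational {K K' : Submodule (ZMod 2) (Facet → ZMod 2)} (h : CodeEquiv K K')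
    (hK : ∀ v ∈ K', IsTranslational v) : ∀ v ∈ K, IsTranslational v := by
  obtain ⟨s, hs, h⟩ := h.symm
  intro v hv
  have := isTranslational_comp hs.symm (hK _ ((h v).2 hv))
  rwa [Function.comp_assoc, Equiv.self_comp_symm, Function.comp_id] at this

theorem CodeEquiv.translational_iff {K K' : Submodule (ZMod 2) (Facet → ZMod 2)}
    (h : CodeEquiv K K') :
    (∀ v ∈ K, IsTranslational v) ↔ ∀ v ∈ K', IsTranslational v :=
  ⟨h.symm.translational, h.translational⟩

theorem CodeEquiv.card_eq {K K' : Submodule (ZMod 2) (Facet → ZMod 2)} (h : CodeEquiv K K') :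
    Nat.card K = Nat.card K' := by
  obtain ⟨s, -, h⟩ := h
  refine (Nat.card_congr ((Equiv.arrowCongr s.symm (Equiv.refl _)).subtypeEquiv fun v => ?_)).symm
  exact (h v).symm

/-- The normal forms are told apart by their orders, the weights of their translational vectors, and
whether all of their vectors are translational. -/
theorem normalForms_injective : ∀ L ∈ normalForms, ∀ L' ∈ normalForms, L.length = L'.length →
    (∀ w ∈ [1, 2, 3], (∃ n ∈ L, IsTranslational (digits n) ∧ hammingNorm (digits n) = 2 * w) ↔
      ∃ n ∈ L', IsTranslational (digits n) ∧ hammingNorm (digits n) = 2 * w) →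
    ((∀ n ∈ L, IsTranslational (digits n)) ↔ ∀ n ∈ L', IsTranslational (digits n)) →
    L = L' := by
  decide +kernel

/-- An even proper code is determined up to equivalence by its order, the weights of its
translational vectors, and whether all of its vectors are translational. -/
theorem codeEquiv_of_invariants {K K' : Submodule (ZMod 2) (Facet → ZMod 2)}
    (hp : IsProperCode K) (he : IsEvenCode K) (hp' : IsProperCode K') (he' : IsEvenCode K')
    (hcard : Nat.card K = Nat.card K')
    (hw : ∀ w ∈ [1, 2, 3], HasWeight K w ↔ HasWeight K' w)
    (ht : (∀ v ∈ K, IsTranslational v) ↔ ∀ v ∈ K', IsTranslational v) : CodeEquiv K K' := by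
  obtain ⟨L, hL⟩ := exists_codeEquiv_normalCode hp he
  obtain ⟨L', hL'⟩ := exists_codeEquiv_normalCode hp' he'
  suffices L = L' by
    subst this
    exact hL.trans hL'.symm
  refine Subtype.ext (normalForms_injective _ L.2 _ L'.2 ?_ (fun w hw' => ?_) ?_)
  · rw [← card_normalCode, ← card_normalCode, ← hL.card_eq, hcard, hL'.card_eq]
  · have := ((hL.hasWeight_iff w).symm.trans (hw w hw')).trans (hL'.hasWeight_iff w)
    simpa [HasWeight, mem_normalCode] using this
  · have := (hL.translational_iff.symm.trans ht).trans hL'.translational_iff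
    simpa [mem_normalCode] using this

/-! ### Symmetries of the cube -/

/-- The signed distance of a point from the plane of a facet, positive on the side of the cube. -/
def depth (x : Space) (f : Facet) : ℝ := if f.2 then 1 - x f.1 else x f.1

theorem depth_not (x : Space) (i : Fin 3) (b : Bool) : depth x (i, !b) = 1 - depth x (i, b) := by
  cases b <;> simp [depth]

theorem depth_ext {x y : Space} (h : ∀ f, depth x f = depth y f) : x = y := by
  ext i
  simpa [depth] using h (i, false)

theorem mem_cube_iff {x : Space} : x ∈ cube ↔ ∀ f, 0 ≤ depth x f := by
  simp only [cube, Set.mem_ofPred_eq, Set.mem_Icc, Prod.forall, Bool.forall_bool, depth]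
  simp

theorem mem_points_iff {x : Space} {f : Facet} :
    x ∈ f.points ↔ x ∈ cube ∧ depth x f = 0 := by
  obtain ⟨i, b⟩ := f
  cases b
  · simp [Facet.points, Facet.level, depth]
  · simp [Facet.points, Facet.level, depth, sub_eq_zero, eq_comm (a := (1 : ℝ))]

theorem depth_reflection (f : Facet) (x : Space) (g : Facet) :
    depth (f.reflection x) g =
      if g = f then - depth x g else if g.1 = f.1 then 2 - depth x g else depth x g := by
  obtain ⟨i, b⟩ := f
  obtain ⟨j, d⟩ := g
  simp only [depth, Facet.reflection_apply, Facet.level, Prod.mk.injEq]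
  by_cases h : j = i <;> cases b <;> cases d <;> simp [h] <;> ring

/-- The map of space that moves the facets by a permutation. -/
def permuteAxes (s : Equiv.Perm Facet) (x : Space) : Space :=
  WithLp.toLp 2 fun j => depth x (s.symm (j, false))

theorem depth_permuteAxes {s : Equiv.Perm Facet} (hs : PreservesParallel s) (x : Space)
    (f : Facet) : depth (permuteAxes s x) f = depth x (s.symm f) := by
  obtain ⟨j, b⟩ := f
  cases b
  · simp [depth, permuteAxes]
  · have h := hs.symm.apply_not j false
    simp only [Bool.not_false] at h
    rw [h, depth_not]
    simp [depth, permuteAxes]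

theorem dist_permuteAxes {s : Equiv.Perm Facet} (hs : PreservesParallel s) (x y : Space) :
    dist (permuteAxes s x) (permuteAxes s y) = dist x y := by
  have hinj : Function.Injective fun j => (s.symm (j, false)).1 := by
    intro j k h
    have := hs _ _ h
    simpa using this
  have hd : ∀ f : Facet, dist (depth x f) (depth y f) = dist (x f.1) (y f.1) := by
    rintro ⟨i, b⟩
    cases b
    · rfl
    · exact dist_sub_left _ _ _
  rw [EuclideanSpace.dist_eq, EuclideanSpace.dist_eq]
  simp only [permuteAxes, hd]
  congr 1
  exact (Equiv.ofBijective _ (Finite.injective_iff_bijective.1 hinj)).sum_comp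
    fun i => dist (x i) (y i) ^ 2

/-- The isometry of space that induces a permutation of the facets. -/
def symmetryIsometry (s : Equiv.Perm Facet) (hs : PreservesParallel s) : Space ≃ᵃⁱ[ℝ] Space :=
  IsometryEquiv.toRealAffineIsometryEquiv
    { toFun := permuteAxes s
      invFun := permuteAxes s.symm
      left_inv := fun x => depth_ext fun f => by
        simp [depth_permuteAxes hs, depth_permuteAxes hs.symm]
      right_inv := fun x => depth_ext fun f => by
        simp [depth_permuteAxes hs, depth_permuteAxes hs.symm]
      isometry_toFun := Isometry.of_dist_eq (dist_permuteAxes hs) }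

theorem depth_symmetryIsometry {s : Equiv.Perm Facet} (hs : PreservesParallel s) (x : Space)
    (f : Facet) : depth (symmetryIsometry s hs x) f = depth x (s.symm f) :=
  depth_permuteAxes hs x f

theorem symmetryIsometry_reflection {s : Equiv.Perm Facet} (hs : PreservesParallel s)
    (f : Facet) (x : Space) :
    symmetryIsometry s hs (f.reflection x) = (s f).reflection (symmetryIsometry s hs x) := by
  refine depth_ext fun g => ?_
  rw [depth_symmetryIsometry, depth_reflection, depth_reflection, depth_symmetryIsometry]
  have : (s.symm g).1 = f.1 ↔ g.1 = (s f).1 :=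
    ⟨fun h => by simpa using hs _ _ h, fun h => by simpa using hs.symm _ _ h⟩
  simp only [this, Equiv.symm_apply_eq]

theorem PreservesParallel.isSymmetry {s : Equiv.Perm Facet} (hs : PreservesParallel s) :
    IsSymmetry s := by
  have hc : ∀ x, symmetryIsometry s hs x ∈ cube ↔ x ∈ cube := fun x => by
    simp only [mem_cube_iff, depth_symmetryIsometry]
    exact (s.symm.surjective.forall (p := fun f => 0 ≤ depth x f)).symm
  refine ⟨symmetryIsometry s hs, ?_, fun f => ?_⟩
  · ext y
    obtain ⟨x, rfl⟩ := (symmetryIsometry s hs).surjective y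
    rw [(symmetryIsometry s hs).injective.mem_set_image, hc]
  · ext y
    obtain ⟨x, rfl⟩ := (symmetryIsometry s hs).surjective y
    rw [(symmetryIsometry s hs).injective.mem_set_image, mem_points_iff, mem_points_iff, hc,
      depth_symmetryIsometry, Equiv.symm_apply_apply]

/-- A set of facets without parallel facets has a common point, a vertex of the cube. -/
theorem nonempty_iInter_points {S : Set Facet} (hS : ∀ i, (i, false) ∈ S → (i, true) ∉ S) :
    (⋂ f ∈ S, f.points).Nonempty := by
  classical
  refine ⟨WithLp.toLp 2 fun i => if (i, true) ∈ S then 1 else 0, ?_⟩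
  simp only [Set.mem_iInter]
  rintro ⟨i, b⟩ hf
  refine ⟨fun j => ?_, ?_⟩
  · change (if (j, true) ∈ S then (1 : ℝ) else 0) ∈ _
    split_ifs <;> simp
  · change (if (i, true) ∈ S then (1 : ℝ) else 0) = _
    cases b
    · simp [Facet.level, hS i hf]
    · simp [Facet.level, hf]

theorem not_mem_points_of_mem_points {x : Space} {i : Fin 3} (h : x ∈ Facet.points (i, false)) :
    x ∉ Facet.points (i, true) := by
  intro h'
  have h1 : x i = _ := h.2
  have h2 : x i = _ := h'.2
  simp [h1, Facet.level] at h2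

/-- Two facets are parallel if and only if they are equal or disjoint. -/
theorem fst_eq_iff {f g : Facet} : f.1 = g.1 ↔ f = g ∨ f.points ∩ g.points = ∅ := by
  constructor
  · intro h
    rcases eq_or_eq_not_of_fst_eq h with h | rfl
    · exact Or.inl h
    · right
      obtain ⟨i, b⟩ := g
      rw [← Set.disjoint_iff_inter_eq_empty]
      cases b
      · exact Set.disjoint_left.2 fun x h h' => not_mem_points_of_mem_points h' h
      · exact Set.disjoint_left.2 fun x h h' => not_mem_points_of_mem_points h h'
  · rintro (rfl | h)
    · rfl
    · by_contra hne
      have : (⋂ k ∈ ({f, g} : Set Facet), k.points).Nonempty := by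
        apply nonempty_iInter_points
        rintro i (rfl | rfl) (h | h)
        · simp at h
        · subst h; exact hne rfl
        · subst h; exact hne rfl
        · simp at h
      rw [Set.biInter_pair, h] at this
      exact Set.not_nonempty_empty this

theorem IsSymmetry.preservesParallel {s : Equiv.Perm Facet} (hs : IsSymmetry s) :
    PreservesParallel s := by
  obtain ⟨φ, -, h⟩ := hs
  intro f g hfg
  rw [fst_eq_iff] at hfg ⊢
  rcases hfg with rfl | hfg
  · exact Or.inl rfl
  · right
    rw [← h, ← h, ← Set.image_inter φ.injective, hfg, Set.image_empty]

/-! ### Colourings and codes -/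

variable {W W' : Type*} [AddCommGroup W] [Module (ZMod 2) W] [AddCommGroup W']
  [Module (ZMod 2) W']

theorem Colouring.mem_code {c : Colouring W} {v : Facet → ZMod 2} :
    v ∈ c.code ↔ ∑ f, v f • c.colour f = 0 := by
  rw [Colouring.code, LinearMap.mem_ker, Fintype.linearCombination_apply]

theorem Colouring.surjective_linearCombination (c : Colouring W) :
    Function.Surjective (Fintype.linearCombination (ZMod 2) c.colour) := by
  rw [← LinearMap.range_eq_top, Fintype.range_linearCombination, c.span_eq_top]

theorem eq_one_of_ne_zero {a : ZMod 2} (h : a ≠ 0) : a = 1 := by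
  revert a; decide

theorem linearCombination_eq (u : Facet → W) (l : Facet →₀ ZMod 2) :
    Finsupp.linearCombination (ZMod 2) u l = Fintype.linearCombination (ZMod 2) u l := by
  rw [Finsupp.linearCombination_apply, Finsupp.sum_fintype _ _ (by simp),
    Fintype.linearCombination_apply]

/-- A relation between colours of facets without a parallel pair would contradict the properness of
the colouring at a vertex of the cube. -/
theorem Colouring.isProperCode (c : Colouring W) : IsProperCode c.code := by
  intro v hv h0
  by_contra! h
  refine h0 ?_
  have hli := c.proper (Function.support v) (nonempty_iInter_points fun i h1 h2 =>
    h i (eq_one_of_ne_zero h1) (eq_one_of_ne_zero h2))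
  rw [linearIndepOn_iff] at hli
  have := hli (Finsupp.equivFunOnFinite.symm v) ?_ ?_
  · funext f
    simpa using DFunLike.congr_fun this f
  · rw [Finsupp.mem_supported]
    intro f hf
    simpa using hf
  · rw [linearCombination_eq]
    simpa [Colouring.code] using hv

/-- Rank-nullity for the map `𝔽₂⁶ → W`. -/
theorem Colouring.card_code [Finite W] (c : Colouring W) :
    Nat.card c.code * 2 ^ Module.finrank (ZMod 2) W = 64 := by
  have h1 := LinearMap.finrank_range_add_finrank_ker (Fintype.linearCombination (ZMod 2) c.colour)
  rw [LinearMap.range_eq_top.2 c.surjective_linearCombination, finrank_top] at h1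
  rw [Module.natCard_eq_pow_finrank (K := ZMod 2) (V := c.code), Nat.card_zmod, ← pow_add]
  rw [Colouring.code, add_comm, h1]
  simp [Fintype.card_prod]

theorem Colouring.finite (c : Colouring W) : Finite W :=
  Finite.of_surjective _ c.surjective_linearCombination

/-- The code determines the colouring up to a linear isomorphism, as `W` is the quotient of `𝔽₂⁶` by
it. -/
theorem Colouring.djEquiv_iff (c : Colouring W) (c' : Colouring W') :
    c.DJEquiv c' ↔ CodeEquiv c.code c'.code := by
  constructor
  · rintro ⟨s, hs, m, h⟩
    refine ⟨s, hs.preservesParallel, fun v => ?_⟩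
    have : ∑ f, (v ∘ s) f • c.colour f = m (∑ f, v f • c'.colour f) := by
      simp only [h, map_sum, map_smul, Function.comp_apply]
      exact Equiv.sum_comp s fun f => v f • m (c'.colour f)
    rw [Colouring.mem_code, Colouring.mem_code, this, map_eq_zero_iff _ m.injective]
  · rintro ⟨s, hs, h⟩
    refine ⟨s, hs.isSymmetry, ?_⟩
    let p : (Facet → ZMod 2) ≃ₗ[ZMod 2] (Facet → ZMod 2) := LinearEquiv.funCongrLeft _ _ s
    let T := Fintype.linearCombination (ZMod 2) c.colour ∘ₗ p.toLinearMap
    let T' := Fintype.linearCombination (ZMod 2) c'.colour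
    have hT : Function.Surjective T := c.surjective_linearCombination.comp p.surjective
    have hT' : Function.Surjective T' := c'.surjective_linearCombination
    have hker : LinearMap.ker T' = LinearMap.ker T := by
      ext v
      exact (h v).symm
    let m := (T'.quotKerEquivOfSurjective hT').symm ≪≫ₗ
      Submodule.quotEquivOfEq _ _ hker ≪≫ₗ T.quotKerEquivOfSurjective hT
    have hm : ∀ v, m (T' v) = T v := by
      intro v
      have : (T'.quotKerEquivOfSurjective hT').symm (T' v) = Submodule.Quotient.mk v := by
        rw [LinearEquiv.symm_apply_eq]
        rfl
      simp only [m, LinearEquiv.trans_apply, this]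
      rfl
    refine ⟨m, fun f => ?_⟩
    have h1 : T' (Pi.single (s f) 1) = c'.colour (s f) := by simp [T']
    have h2 : T (Pi.single (s f) 1) = c.colour f := by
      have : p (Pi.single (s f) 1) = Pi.single f 1 := by
        funext g
        simp [p, LinearMap.funLeft, Pi.single_apply]
      simp only [T, LinearMap.comp_apply, LinearEquiv.coe_coe, this]
      simp
    rw [← h1, hm, h2]

/-- A proper code of suitable order is the code of a colouring. -/
theorem exists_colouring_code_eq {K : Submodule (ZMod 2) (Facet → ZMod 2)} (hK : IsProperCode K)
    [Module.Finite (ZMod 2) W] (hcard : Nat.card K * 2 ^ Module.finrank (ZMod 2) W = 64) :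
    ∃ c : Colouring W, c.code = K := by
  have h1 := Submodule.finrank_quotient_add_finrank K
  have h2 : Module.finrank (ZMod 2) (Facet → ZMod 2) = 6 := by simp [Fintype.card_prod]
  have h3 : Module.finrank (ZMod 2) ((Facet → ZMod 2) ⧸ K) = Module.finrank (ZMod 2) W := by
    rw [Module.natCard_eq_pow_finrank (K := ZMod 2) (V := K), Nat.card_zmod, ← pow_add] at hcard
    have := Nat.pow_right_injective le_rfl (hcard.trans (by norm_num : 64 = 2 ^ 6))
    omega
  let e := LinearEquiv.ofFinrankEq _ _ h3
  let T : (Facet → ZMod 2) →ₗ[ZMod 2] W := e.toLinearMap ∘ₗ K.mkQ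
  have hT : Fintype.linearCombination (ZMod 2) (fun f => T (Pi.single f 1)) = T := by
    apply LinearMap.pi_ext'
    intro f
    ext
    simp
  have hker : LinearMap.ker T = K := by
    rw [LinearMap.ker_comp_of_ker_eq_bot _ e.ker, Submodule.ker_mkQ]
  refine ⟨⟨fun f => T (Pi.single f 1), ?_, fun S hS => ?_⟩, ?_⟩
  · rw [← Fintype.range_linearCombination, hT, LinearMap.range_eq_top]
    exact e.surjective.comp K.mkQ_surjective
  · rw [linearIndepOn_iff]
    intro l hl h0
    by_contra hne
    rw [linearCombination_eq, hT,
      ← LinearMap.mem_ker, hker] at h0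
    obtain ⟨i, h1, h2⟩ := hK _ h0 (fun h => hne (DFunLike.coe_injective h))
    obtain ⟨x, hx⟩ := hS
    simp only [Set.mem_iInter] at hx
    rw [Finsupp.mem_supported] at hl
    have hmem : ∀ f, l f = 1 → f ∈ S := fun f hf => hl (by simp [hf])
    exact not_mem_points_of_mem_points (hx _ (hmem _ h1)) (hx _ (hmem _ h2))
  · rw [Colouring.code, hT, hker]

/-! ### Coordinates for the reflection group -/

/-- The isometry `g` is given by `xᵢ ↦ ± xᵢ + 2 nᵢ`, where the sign is negative if `e i` holds.
The isometries of this form are those by which the Coxeter group acts. -/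
def ActsBy (g : Space ≃ᵃⁱ[ℝ] Space) (e : Fin 3 → Bool) (n : Fin 3 → ℤ) : Prop :=
  ∀ x i, g x i = (if e i then - x i else x i) + 2 * n i

/-- The number, modulo two, of the reflections in each facet in a word that represents the isometry
`xᵢ ↦ ± xᵢ + 2 nᵢ`. On the axis `i`, this isometry is the `nᵢ`-th power of the translation
`r (i, true) * r (i, false)`, times `r (i, false)` if the sign is negative. -/
def facetVector (e : Fin 3 → Bool) (n : Fin 3 → ℤ) : Facet → ZMod 2 :=
  fun f => n f.1 + if !f.2 && e f.1 then 1 else 0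

theorem ActsBy.ext {g h : Space ≃ᵃⁱ[ℝ] Space} {e : Fin 3 → Bool} {n : Fin 3 → ℤ}
    (hg : ActsBy g e n) (hh : ActsBy h e n) : g = h := by
  ext x i
  rw [hg, hh]

theorem ActsBy.unique {g : Space ≃ᵃⁱ[ℝ] Space} {e e' : Fin 3 → Bool} {n n' : Fin 3 → ℤ}
    (h : ActsBy g e n) (h' : ActsBy g e' n') : e = e' ∧ n = n' := by
  have hn : n = n' := by
    funext i
    have h0 := (h 0 i).symm.trans (h' 0 i)
    simpa using h0
  subst hn
  refine ⟨funext fun i => ?_, rfl⟩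
  have h1 := (h (EuclideanSpace.single i 1) i).symm.trans (h' (EuclideanSpace.single i 1) i)
  cases he : e i <;> cases he' : e' i <;> simp [he, he'] at h1 ⊢ <;> norm_num at h1

theorem ActsBy.one : ActsBy 1 (fun _ => false) 0 := by
  intro x i
  simp

theorem ActsBy.mul {g h : Space ≃ᵃⁱ[ℝ] Space} {e e' : Fin 3 → Bool} {n n' : Fin 3 → ℤ}
    (hg : ActsBy g e n) (hh : ActsBy h e' n') :
    ActsBy (g * h) (fun i => xor (e i) (e' i)) fun i => n i + if e i then - n' i else n' i := by
  intro x i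
  change g (h x) i = _
  rw [hg, hh]
  cases he : e i <;> cases he' : e' i <;> simp [he, he'] <;> ring

theorem ActsBy.inv {g : Space ≃ᵃⁱ[ℝ] Space} {e : Fin 3 → Bool} {n : Fin 3 → ℤ}
    (hg : ActsBy g e n) : ActsBy g⁻¹ e fun i => if e i then n i else - n i := by
  intro x i
  have h : g (g⁻¹ x) i = x i := congrArg (fun y : Space => y i) (g.apply_symm_apply x)
  rw [hg] at h
  rw [← h]
  cases he : e i <;> simp [he]

theorem actsBy_reflection (f : Facet) : ActsBy f.reflection (fun i => decide (i = f.1))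
    fun i => if i = f.1 ∧ f.2 = true then 1 else 0 := by
  intro x i
  rw [Facet.reflection_apply]
  by_cases h : i = f.1 <;> cases hf : f.2 <;> simp [h, hf, Facet.level]
  ring

theorem geometricRep_simple (f : Facet) : geometricRep (coxeterMatrix.simple f) = f.reflection :=
  coxeterMatrix.toCoxeterSystem.lift_apply_simple isLiftable_reflection f

theorem Colouring.hom_simple (c : Colouring W) (f : Facet) :
    c.hom (coxeterMatrix.simple f) = Multiplicative.ofAdd (c.colour f) :=
  coxeterMatrix.toCoxeterSystem.lift_apply_simple c.isLiftable f

theorem facetVector_reflection_mul (f : Facet) (e : Fin 3 → Bool) (n : Fin 3 → ℤ) :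
    facetVector (fun i => xor (decide (i = f.1)) (e i))
      (fun i => (if i = f.1 ∧ f.2 = true then 1 else 0) +
        if decide (i = f.1) then - n i else n i) = Pi.single f 1 + facetVector e n := by
  funext g
  obtain ⟨i, b⟩ := f
  obtain ⟨j, d⟩ := g
  have h2 : (1 : ZMod 2) + 1 = 0 := by decide
  by_cases h : j = i
  · subst h
    cases b <;> cases d <;> cases he : e j <;>
      simp [facetVector, he, ZModModule.neg_eq_self, add_comm, add_left_comm, h2]
  · simp [facetVector, h]

/-- The image of a word is determined by the isometry by which it acts. -/
theorem exists_actsBy (c : Colouring W) (w : CoxeterGroup) : ∃ e n, ActsBy (geometricRep w) e n ∧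
    (c.hom w).toAdd = ∑ f, facetVector e n f • c.colour f := by
  induction w using coxeterMatrix.toCoxeterSystem.simple_induction_left with
  | one =>
    refine ⟨_, _, by rw [map_one]; exact ActsBy.one, ?_⟩
    simp [facetVector]
  | mul_simple_left w f ih =>
    obtain ⟨e, n, h1, h2⟩ := ih
    rw [CoxeterMatrix.toCoxeterSystem_simple, map_mul, map_mul, geometricRep_simple, c.hom_simple,
      toAdd_mul, h2]
    refine ⟨_, _, (actsBy_reflection f).mul h1, ?_⟩
    rw [facetVector_reflection_mul]
    simp [add_smul, Finset.sum_add_distrib, Pi.single_apply]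

/-- A product of reflections on the axis `i`. -/
theorem exists_word_axis (i : Fin 3) (b : Bool) (k : ℤ) : ∃ w, ActsBy (geometricRep w)
    (fun j => decide (j = i) && b) fun j => if j = i then k else 0 := by
  have ht : ∀ k : ℤ, ∃ w, ActsBy (geometricRep w) (fun _ => false)
      fun j => if j = i then k else 0 := by
    have h1 := (actsBy_reflection (i, true)).mul (actsBy_reflection (i, false))
    rw [← geometricRep_simple, ← geometricRep_simple, ← map_mul] at h1
    intro k
    induction k with
    | zero => exact ⟨1, by rw [map_one]; simpa using! ActsBy.one⟩
    | succ k ih =>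
      obtain ⟨w, hw⟩ := ih
      refine ⟨w * (coxeterMatrix.simple (i, true) * coxeterMatrix.simple (i, false)), ?_⟩
      rw [map_mul]
      convert hw.mul h1 using 2 with j j
      · simp
      · by_cases h : j = i <;> simp [h]
    | pred k ih =>
      obtain ⟨w, hw⟩ := ih
      refine ⟨w * (coxeterMatrix.simple (i, true) * coxeterMatrix.simple (i, false))⁻¹, ?_⟩
      rw [map_mul, map_inv]
      convert hw.mul h1.inv using 2 with j j
      · simp
      · by_cases h : j = i <;> simp [h]; ring
  obtain ⟨w, hw⟩ := ht k
  cases b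
  · exact ⟨w, by simpa using hw⟩
  · refine ⟨w * coxeterMatrix.simple (i, false), ?_⟩
    rw [map_mul, geometricRep_simple]
    convert hw.mul (actsBy_reflection (i, false)) using 2 with j j
    · simp
    · simp

theorem exists_word (e : Fin 3 → Bool) (n : Fin 3 → ℤ) : ∃ w, ActsBy (geometricRep w) e n := by
  obtain ⟨w0, h0⟩ := exists_word_axis 0 (e 0) (n 0)
  obtain ⟨w1, h1⟩ := exists_word_axis 1 (e 1) (n 1)
  obtain ⟨w2, h2⟩ := exists_word_axis 2 (e 2) (n 2)
  refine ⟨w0 * (w1 * w2), ?_⟩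
  rw [map_mul, map_mul]
  convert h0.mul (h1.mul h2) using 2 with j j
  · fin_cases j <;> simp
  · fin_cases j <;> simp

/-- The group `ker λ` in coordinates. No faithfulness of the action of the Coxeter group is needed,
since the colour of a word depends only on the isometry by which it acts. -/
theorem Colouring.mem_kernelGroup {c : Colouring W} {g : Space ≃ᵃⁱ[ℝ] Space} :
    g ∈ c.kernelGroup ↔ ∃ e n, ActsBy g e n ∧ facetVector e n ∈ c.code := by
  simp only [Colouring.kernelGroup, Subgroup.mem_map, MonoidHom.mem_ker, Colouring.mem_code]
  constructor
  · rintro ⟨w, hw, rfl⟩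
    obtain ⟨e, n, h1, h2⟩ := exists_actsBy c w
    refine ⟨e, n, h1, ?_⟩
    rw [← h2, hw, toAdd_one]
  · rintro ⟨e, n, h1, h2⟩
    obtain ⟨w, hw⟩ := exists_word e n
    obtain ⟨e', n', h3, h4⟩ := exists_actsBy c w
    obtain ⟨rfl, rfl⟩ := hw.unique h3
    refine ⟨w, ?_, hw.ext h1⟩
    rw [h2] at h4
    exact h4

theorem exists_isometry (e : Fin 3 → Bool) (n : Fin 3 → ℤ) : ∃ g, ActsBy g e n :=
  (exists_word e n).imp' geometricRep fun _ h => h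

theorem exists_facetVector_eq (v : Facet → ZMod 2) : ∃ e n, facetVector e n = v := by
  refine ⟨fun i => decide (v (i, false) ≠ v (i, true)), fun i => (v (i, true)).val, ?_⟩
  funext f
  obtain ⟨i, b⟩ := f
  have h : ∀ x y : ZMod 2, (y.val : ZMod 2) + (if x ≠ y then 1 else 0) = x := by decide
  cases b
  · simpa [facetVector] using h (v (i, false)) (v (i, true))
  · simp [facetVector]

/-! ### Orientability, translations and commutativity -/

theorem det_of_actsBy {g : Space ≃ᵃⁱ[ℝ] Space} {e : Fin 3 → Bool} {n : Fin 3 → ℤ}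
    (h : ActsBy g e n) :
    LinearMap.det (g.linearIsometryEquiv.toLinearEquiv : Space →ₗ[ℝ] Space) =
      ∏ i, if e i then (-1 : ℝ) else 1 := by
  have hl : ∀ x i, g.linearIsometryEquiv x i = if e i then - x i else x i := by
    intro x i
    have h1 : g.linearIsometryEquiv x = g x - g 0 := by
      simpa using g.map_vsub x 0
    rw [h1, PiLp.sub_apply, h, h]
    cases e i <;> simp
  rw [← LinearMap.det_toMatrix (EuclideanSpace.basisFun (Fin 3) ℝ).toBasis,
    ← Matrix.det_diagonal]
  congr 1
  ext i j
  rw [LinearMap.toMatrix_apply]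
  simp only [OrthonormalBasis.coe_toBasis, OrthonormalBasis.coe_toBasis_repr_apply,
    EuclideanSpace.basisFun_apply, EuclideanSpace.basisFun_repr]
  change g.linearIsometryEquiv (EuclideanSpace.single j 1) i = _
  rw [hl]
  by_cases hij : i = j
  · subst hij
    simp
  · simp [hij]

theorem prod_pos_iff (e : Fin 3 → Bool) (n : Fin 3 → ℤ) :
    0 < ∏ i, (if e i then (-1 : ℝ) else 1) ↔ ∑ f, facetVector e n f = 0 := by
  have h : ∑ f, facetVector e n f = ∑ i, if e i then (1 : ZMod 2) else 0 := by
    rw [Fintype.sum_prod_type]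
    refine Finset.sum_congr rfl fun i _ => ?_
    simp only [Fintype.sum_bool, facetVector]
    have h2 : (n i : ZMod 2) + n i = 0 := ZModModule.add_self _
    cases e i <;> simp [← add_assoc, h2]
  rw [h, Fin.prod_univ_three, Fin.sum_univ_three]
  have h2 : (1 : ZMod 2) + 1 = 0 := by decide
  cases e 0 <;> cases e 1 <;> cases e 2 <;> simp [h2]

/-- An element of `ker λ` is a product of reflections, so it preserves the orientation if and only
if their number is even. -/
theorem Colouring.orientable_iff (c : Colouring W) : c.Orientable ↔ IsEvenCode c.code := by
  constructor
  · intro h v hv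
    obtain ⟨e, n, rfl⟩ := exists_facetVector_eq v
    obtain ⟨g, hg⟩ := exists_isometry e n
    rw [← prod_pos_iff, ← det_of_actsBy hg]
    exact h g (Colouring.mem_kernelGroup.2 ⟨e, n, hg, hv⟩)
  · intro h g hg
    obtain ⟨e, n, hg, hv⟩ := Colouring.mem_kernelGroup.1 hg
    rw [det_of_actsBy hg, prod_pos_iff e n]
    exact h _ hv

theorem isTranslational_facetVector {e : Fin 3 → Bool} {n : Fin 3 → ℤ} :
    IsTranslational (facetVector e n) ↔ e = fun _ => false := by
  rw [funext_iff]
  refine forall_congr' fun i => ?_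
  cases h : e i <;> simp [facetVector, h]

theorem Colouring.mem_toricLattice {c : Colouring W} {v : Space} :
    v ∈ c.toricLattice ↔
      ∃ n : Fin 3 → ℤ, (∀ i, v i = 2 * n i) ∧ facetVector (fun _ => false) n ∈ c.code := by
  change AffineIsometryEquiv.constVAdd ℝ Space v ∈ c.kernelGroup ↔ _
  rw [Colouring.mem_kernelGroup]
  constructor
  · rintro ⟨e, n, h, hv⟩
    have h0 : ∀ i, v i = 2 * n i := fun i => by simpa using h 0 i
    have h' : ActsBy (AffineIsometryEquiv.constVAdd ℝ Space v) (fun _ => false) n := by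
      intro x i
      simp [h0, add_comm]
    obtain ⟨rfl, -⟩ := h.unique h'
    exact ⟨n, h0, hv⟩
  · rintro ⟨n, h0, hv⟩
    refine ⟨_, n, fun x i => ?_, hv⟩
    simp [h0, add_comm]

theorem hammingNorm_facetVector (n : Fin 3 → ℤ) :
    hammingNorm (facetVector (fun _ => false) n) =
      2 * ∑ i, if (n i : ZMod 2) = 0 then 0 else 1 := by
  rw [hammingNorm, Finset.card_filter, Fintype.sum_prod_type, Finset.mul_sum]
  refine Finset.sum_congr rfl fun i _ => ?_
  by_cases h : (n i : ZMod 2) = 0 <;> simp [facetVector, h]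

/-- The short vectors of the toric lattice, those of length at most `2 √3`, have coordinates
`0` and `± 2`, so that they are visible in the code. -/
theorem Colouring.mem_lengthSpectrum_iff {c : Colouring W} {w : ℕ} (hw : w ∈ [1, 2, 3]) :
    2 * √(w : ℝ) ∈ c.lengthSpectrum ↔ HasWeight c.code w := by
  have hw' : 1 ≤ w ∧ w ≤ 3 := by
    simp at hw
    omega
  have hnorm : ∀ (v : Space) (n : Fin 3 → ℤ), (∀ i, v i = 2 * n i) →
      (‖v‖ = 2 * √(w : ℝ) ↔ ∑ i, n i ^ 2 = w) := by
    intro v n h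
    have h1 : ‖v‖ ^ 2 = 4 * ((∑ i, n i ^ 2 : ℤ) : ℝ) := by
      rw [EuclideanSpace.norm_sq_eq]
      push_cast
      rw [Finset.mul_sum]
      refine Finset.sum_congr rfl fun i _ => ?_
      rw [h, Real.norm_eq_abs, sq_abs]
      ring
    rw [← sq_eq_sq₀ (norm_nonneg _) (by positivity), h1, mul_pow,
      Real.sq_sqrt (Nat.cast_nonneg w)]
    have : ((∑ i, n i ^ 2 : ℤ) : ℝ) = (w : ℝ) ↔ ∑ i, n i ^ 2 = (w : ℤ) := by norm_cast
    rw [← this]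
    constructor <;> intro h <;> linarith
  constructor
  · rintro ⟨v, hv, -, hl⟩
    obtain ⟨n, hn, hc⟩ := Colouring.mem_toricLattice.1 hv
    refine ⟨_, hc, isTranslational_facetVector.2 rfl, ?_⟩
    rw [hammingNorm_facetVector]
    congr 1
    have hs := (hnorm v n hn).1 hl
    have hb : ∀ i, (if (n i : ZMod 2) = 0 then 0 else 1) = n i ^ 2 := by
      intro i
      have h1 : n i ^ 2 ≤ w := by
        rw [← hs]
        exact Finset.single_le_sum (f := fun i => n i ^ 2) (fun i _ => sq_nonneg _)
          (Finset.mem_univ i)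
      have h2 : n i ≤ 1 := by nlinarith
      have h3 : -1 ≤ n i := by nlinarith
      generalize n i = k at h2 h3
      interval_cases k <;> decide
    zify
    rw [← hs]
    exact Finset.sum_congr rfl fun i _ => hb i
  · rintro ⟨u, hu, ht, hh⟩
    obtain ⟨e, n, rfl⟩ := exists_facetVector_eq u
    obtain rfl := isTranslational_facetVector.1 ht
    let m : Fin 3 → ℤ := fun i => if (n i : ZMod 2) = 0 then 0 else 1
    have hm : facetVector (fun _ => false) m = facetVector (fun _ => false) n := by
      funext f
      simp only [facetVector, m]
      by_cases h : (n f.1 : ZMod 2) = 0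
      · simp [h]
      · simp [eq_one_of_ne_zero h]
    have hs : ∑ i, m i ^ 2 = w := by
      rw [hammingNorm_facetVector] at hh
      have : (∑ i, if (n i : ZMod 2) = 0 then 0 else 1) = w := by omega
      rw [← this]
      push_cast
      refine Finset.sum_congr rfl fun i _ => ?_
      by_cases h : (n i : ZMod 2) = 0 <;> simp [m, h]
    let v : Space := WithLp.toLp 2 fun i => 2 * (m i : ℝ)
    have hl := (hnorm v m fun i => rfl).2 hs
    refine ⟨v, Colouring.mem_toricLattice.2 ⟨m, fun i => rfl, by rwa [hm]⟩, ?_, hl⟩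
    rw [← norm_ne_zero_iff, hl]
    have : (0 : ℝ) < w := by exact_mod_cast hw'.1
    positivity

/-- An element of `ker λ` that is not a translation does not commute with all translations of the
lattice `4 ℤ³`, which is contained in `ker λ` for each `λ`. -/
theorem Colouring.commute_iff (c : Colouring W) :
    (∀ g ∈ c.kernelGroup, ∀ h ∈ c.kernelGroup, g * h = h * g) ↔
      ∀ v ∈ c.code, IsTranslational v := by
  constructor
  · intro hc v hv
    obtain ⟨e, n, rfl⟩ := exists_facetVector_eq v
    obtain ⟨g, hg⟩ := exists_isometry e n
    rw [isTranslational_facetVector]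
    obtain ⟨h, hh⟩ := exists_isometry (fun _ => false) (fun _ => 2)
    have h0 : facetVector (fun _ => false) (fun _ => 2) = 0 := by
      have : (2 : ZMod 2) = 0 := by decide
      funext f
      simp [facetVector, this]
    have := hc g (Colouring.mem_kernelGroup.2 ⟨e, n, hg, hv⟩) h
      (Colouring.mem_kernelGroup.2 ⟨_, _, hh, h0 ▸ c.code.zero_mem⟩)
    have h1 := hg.mul hh
    rw [this] at h1
    have h2 := congrFun (h1.unique (hh.mul hg)).2
    funext i
    have h3 := h2 i
    cases he : e i
    · rfl
    · simp [he] at h3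
      omega
  · intro ht g hg h hh
    obtain ⟨e, n, hg, hv⟩ := Colouring.mem_kernelGroup.1 hg
    obtain ⟨e', n', hh, hv'⟩ := Colouring.mem_kernelGroup.1 hh
    obtain rfl := isTranslational_facetVector.1 (ht _ hv)
    obtain rfl := isTranslational_facetVector.1 (ht _ hv')
    refine (hg.mul hh).ext ?_
    convert hh.mul hg using 2
    simp [add_comm]

/-- The nontrivial elements of `ker λ` displace each point by at least `2`. -/
theorem Colouring.two_le_dist {c : Colouring W} {g : Space ≃ᵃⁱ[ℝ] Space} (hg : g ∈ c.kernelGroup)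
    (h1 : g ≠ 1) (x : Space) : 2 ≤ dist (g x) x := by
  obtain ⟨e, n, hg, hv⟩ := Colouring.mem_kernelGroup.1 hg
  obtain ⟨i, hi, hn⟩ : ∃ i, e i = false ∧ n i ≠ 0 := by
    by_cases h0 : facetVector e n = 0
    · have he : e = fun _ => false := isTranslational_facetVector.1 (by rw [h0]; intro; rfl)
      subst he
      by_contra! h
      have hn : n = 0 := funext fun i => h i rfl
      subst hn
      exact h1 (hg.ext ActsBy.one)
    · obtain ⟨i, h2, h3⟩ := c.isProperCode _ hv h0
      refine ⟨i, ?_, ?_⟩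
      · simp only [facetVector] at h2 h3
        cases he : e i
        · rfl
        · simp [he] at h2 h3
          simp [h3] at h2
      · rintro hn
        simp [facetVector, hn] at h3
  have hle : ‖(g x - x) i‖ ≤ ‖g x - x‖ := PiLp.norm_apply_le _ _
  rw [dist_eq_norm]
  refine le_trans ?_ hle
  rw [PiLp.sub_apply, hg, hi]
  simp only [Bool.false_eq_true, if_false, add_sub_cancel_left, norm_mul, Real.norm_ofNat]
  have : (1 : ℝ) ≤ ‖(n i : ℝ)‖ := by
    rw [Real.norm_eq_abs]
    exact_mod_cast Int.one_le_abs hn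
  linarith

/-! ### The volume -/

theorem measurePreserving_affineIsometryEquiv (g : Space ≃ᵃⁱ[ℝ] Space) :
    MeasureTheory.MeasurePreserving g := by
  have h : (g : Space → Space) = (fun x => x + g 0) ∘ g.linearIsometryEquiv := by
    funext x
    have h1 : g.linearIsometryEquiv x = g x - g 0 := by simpa using g.map_vsub x 0
    simp [h1]
  rw [h]
  exact (MeasureTheory.measurePreserving_add_right _ _).comp
    g.linearIsometryEquiv.measurePreserving

/-- The interior of the cube. -/
def openCube : Set Space := {x | ∀ i, x i ∈ Set.Ioo (0 : ℝ) 1}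

theorem openCube_eq : openCube = WithLp.ofLp ⁻¹' Set.univ.pi fun _ => Set.Ioo (0 : ℝ) 1 := by
  ext x
  simp [openCube]

theorem measurableSet_openCube : MeasurableSet openCube := by
  rw [openCube_eq]
  exact (PiLp.volume_preserving_ofLp (Fin 3)).measurable
    (MeasurableSet.univ_pi fun _ => measurableSet_Ioo)

theorem volume_openCube : MeasureTheory.volume openCube = 1 := by
  rw [openCube_eq, (PiLp.volume_preserving_ofLp (Fin 3)).measure_preimage
    (MeasurableSet.univ_pi fun _ => measurableSet_Ioo).nullMeasurableSet]
  simp [Real.volume_pi_Ioo]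

theorem ae_notMem_range_intCast :
    ∀ᵐ x : Space, ∀ i, x i ∉ Set.range ((↑) : ℤ → ℝ) := by
  rw [MeasureTheory.ae_all_iff]
  intro i
  have h : MeasureTheory.Measure.QuasiMeasurePreserving (fun x : Space => x i)
      MeasureTheory.volume MeasureTheory.volume :=
    (MeasureTheory.Measure.quasiMeasurePreserving_eval _ i).comp
      (PiLp.volume_preserving_ofLp (Fin 3)).quasiMeasurePreserving
  exact h.ae ((Set.countable_range _).ae_notMem _)

/-- The Coxeter group moves each point that is on none of the mirrors into the interior of the
cube. -/
theorem exists_apply_mem_openCube {x : Space} (hx : ∀ i, x i ∉ Set.range ((↑) : ℤ → ℝ)) :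
    ∃ w, geometricRep w x ∈ openCube := by
  have h : ∀ i, ∃ (e : Bool) (n : ℤ), (if e then - x i else x i) + 2 * n ∈ Set.Ioo (0 : ℝ) 1 := by
    intro i
    have h0 : (⌊x i⌋ : ℝ) < x i := lt_of_le_of_ne (Int.floor_le _) fun h => hx i ⟨_, h⟩
    have h1 : x i < ⌊x i⌋ + 1 := Int.lt_floor_add_one _
    rcases Int.even_or_odd' ⌊x i⌋ with ⟨k, hk | hk⟩
    · refine ⟨false, -k, ?_⟩
      rw [hk] at h0 h1
      push_cast at h0 h1
      constructor <;> simp <;> linarith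
    · refine ⟨true, k + 1, ?_⟩
      rw [hk] at h0 h1
      push_cast at h0 h1
      constructor <;> simp <;> linarith
  choose e n h using h
  obtain ⟨w, hw⟩ := exists_word e n
  refine ⟨w, fun i => ?_⟩
  rw [hw]
  exact h i

/-- The translates of the open cube under the reflection group are disjoint. -/
theorem ActsBy.eq_one_of_mem_openCube {g : Space ≃ᵃⁱ[ℝ] Space} {e : Fin 3 → Bool}
    {n : Fin 3 → ℤ} (hg : ActsBy g e n) {x : Space} (hx : x ∈ openCube) (hgx : g x ∈ openCube) :
    g = 1 := by
  suffices ∀ i, e i = false ∧ n i = 0 by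
    obtain rfl : e = fun _ => false := funext fun i => (this i).1
    obtain rfl : n = 0 := funext fun i => (this i).2
    exact hg.ext ActsBy.one
  intro i
  have h1 := hx i
  have h2 := hgx i
  rw [hg] at h2
  cases he : e i
  · simp only [he, Bool.false_eq_true, if_false, Set.mem_Ioo] at h1 h2
    have h3 : (n i : ℝ) < 1 := by linarith
    have h4 : (-1 : ℝ) < n i := by linarith
    have h3' : n i < 1 := by exact_mod_cast h3
    have h4' : -1 < n i := by exact_mod_cast h4
    exact ⟨rfl, by omega⟩
  · simp only [he, if_true, Set.mem_Ioo] at h1 h2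
    have h3 : (n i : ℝ) < 1 := by linarith
    have h4 : (0 : ℝ) < n i := by linarith
    have h3' : n i < 1 := by exact_mod_cast h3
    have h4' : 0 < n i := by exact_mod_cast h4
    omega

theorem Colouring.hom_eq_one {c : Colouring W} {w : CoxeterGroup} (h : geometricRep w = 1) :
    c.hom w = 1 := by
  obtain ⟨e, n, h1, h2⟩ := exists_actsBy c w
  rw [h] at h1
  obtain ⟨rfl, rfl⟩ := h1.unique ActsBy.one
  rw [← toAdd_eq_zero, h2]
  simp [facetVector]

theorem Colouring.hom_surjective (c : Colouring W) : Function.Surjective c.hom := by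
  intro a
  obtain ⟨v, hv⟩ := c.surjective_linearCombination a.toAdd
  obtain ⟨e, n, rfl⟩ := exists_facetVector_eq v
  obtain ⟨w, hw⟩ := exists_word e n
  obtain ⟨e', n', h1, h2⟩ := exists_actsBy c w
  obtain ⟨rfl, rfl⟩ := hw.unique h1
  refine ⟨w, ?_⟩
  rw [← Multiplicative.toAdd.injective.eq_iff, h2, ← hv, Fintype.linearCombination_apply]

/-- A word of a given colour. -/
def Colouring.word (c : Colouring W) (a : Multiplicative W) : CoxeterGroup :=
  (c.hom_surjective a).choose

theorem Colouring.hom_word (c : Colouring W) (a : Multiplicative W) : c.hom (c.word a) = a :=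
  (c.hom_surjective a).choose_spec

/-- A fundamental domain for `ker λ`: the union of one translate of the cube for each colour. -/
def Colouring.domain (c : Colouring W) : Set Space :=
  ⋃ a, geometricRep (c.word a) '' openCube

theorem Colouring.eq_of_apply_eq (c : Colouring W) {k : CoxeterGroup} (hk : c.hom k = 1)
    {a b : Multiplicative W} {x y : Space} (hx : x ∈ openCube) (hy : y ∈ openCube)
    (h : geometricRep k (geometricRep (c.word a) x) = geometricRep (c.word b) y) :
    a = b ∧ geometricRep k = 1 := by
  have h1 : geometricRep ((c.word b)⁻¹ * (k * c.word a)) x = y := by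
    rw [map_mul, map_inv, map_mul]
    change (geometricRep (c.word b)).symm (geometricRep k (geometricRep (c.word a) x)) = y
    rw [h, AffineIsometryEquiv.symm_apply_apply]
  obtain ⟨e, n, hen, -⟩ := exists_actsBy c ((c.word b)⁻¹ * (k * c.word a))
  have h2 := hen.eq_one_of_mem_openCube hx (h1.symm ▸ hy)
  have h3 := c.hom_eq_one h2
  rw [map_mul, map_inv, map_mul, c.hom_word, c.hom_word, hk, one_mul, inv_mul_eq_one] at h3
  subst h3
  refine ⟨rfl, ?_⟩
  rw [map_mul, map_inv, map_mul, inv_mul_eq_one] at h2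
  exact mul_eq_right.1 h2.symm

theorem measurableSet_image (g : Space ≃ᵃⁱ[ℝ] Space) {S : Set Space} (hS : MeasurableSet S) :
    MeasurableSet (g '' S) :=
  g.toHomeomorph.measurableEmbedding.measurableSet_image.2 hS

theorem Colouring.measurableSet_domain (c : Colouring W) : MeasurableSet c.domain := by
  have := c.finite
  exact MeasurableSet.iUnion fun a => measurableSet_image _ measurableSet_openCube

theorem volume_image (g : Space ≃ᵃⁱ[ℝ] Space) {S : Set Space} (hS : MeasurableSet S) :
    MeasureTheory.volume (g '' S) = MeasureTheory.volume S := by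
  rw [← (measurePreserving_affineIsometryEquiv g).measure_preimage
    (measurableSet_image g hS).nullMeasurableSet, Set.preimage_image_eq _ g.injective]

theorem Colouring.volume_domain (c : Colouring W) :
    MeasureTheory.volume c.domain = 2 ^ Module.finrank (ZMod 2) W := by
  have := c.finite
  have := Fintype.ofFinite W
  rw [Colouring.domain, MeasureTheory.measure_iUnion]
  · simp only [volume_image _ measurableSet_openCube, volume_openCube, tsum_fintype]
    rw [Finset.sum_const, Finset.card_univ, Fintype.card_multiplicative,
      Module.card_eq_pow_finrank (K := ZMod 2), ZMod.card]
    simp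
  · intro a b hab
    refine Set.disjoint_left.2 ?_
    rintro _ ⟨x, hx, rfl⟩ ⟨y, hy, h⟩
    refine hab (c.eq_of_apply_eq (k := 1) (map_one _) hx hy ?_).1
    rw [h, map_one]
    rfl
  · exact fun a => measurableSet_image _ measurableSet_openCube

instance (c : Colouring W) : Countable c.kernelGroup := by
  have h : ∀ g : c.kernelGroup, ∃ p : (Fin 3 → Bool) × (Fin 3 → ℤ), ActsBy g.1 p.1 p.2 := by
    rintro ⟨g, hg⟩
    obtain ⟨e, n, h, -⟩ := Colouring.mem_kernelGroup.1 hg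
    exact ⟨(e, n), h⟩
  choose p hp using h
  refine Function.Injective.countable (f := p) fun g h hgh => ?_
  have := hp g
  rw [hgh] at this
  exact Subtype.ext (this.ext (hp h))

instance (c : Colouring W) : MeasurableConstSMul c.kernelGroup Space where
  measurable_const_smul g := g.1.continuous.measurable

instance (c : Colouring W) :
    MeasureTheory.SMulInvariantMeasure c.kernelGroup Space MeasureTheory.volume where
  measure_preimage_smul g _ hS :=
    (measurePreserving_affineIsometryEquiv g.1).measure_preimage hS.nullMeasurableSet

theorem Colouring.isFundamentalDomain (c : Colouring W) :
    MeasureTheory.IsFundamentalDomain c.kernelGroup c.domain := by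
  refine MeasureTheory.IsFundamentalDomain.mk'' c.measurableSet_domain.nullMeasurableSet ?_ ?_ ?_
  · filter_upwards [ae_notMem_range_intCast] with x hx
    obtain ⟨w, hw⟩ := exists_apply_mem_openCube hx
    refine ⟨⟨geometricRep (c.word (c.hom w)⁻¹ * w), _, ?_, rfl⟩, ?_⟩
    · change c.hom _ = 1
      rw [map_mul, c.hom_word, inv_mul_cancel]
    · refine Set.mem_iUnion.2 ⟨(c.hom w)⁻¹, _, hw, ?_⟩
      change _ = geometricRep (c.word (c.hom w)⁻¹ * w) x
      rw [map_mul]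
      rfl
  · rintro ⟨_, k, hk, rfl⟩ hne
    refine Disjoint.aedisjoint (Set.disjoint_left.2 ?_)
    rintro _ ⟨y, hy, rfl⟩ hz
    obtain ⟨a, x, hx, rfl⟩ := Set.mem_iUnion.1 hy
    obtain ⟨b, z, hz, h⟩ := Set.mem_iUnion.1 hz
    exact hne (Subtype.ext (c.eq_of_apply_eq hk hx hz h.symm).2)
  · exact fun g => (measurePreserving_affineIsometryEquiv g.1).quasiMeasurePreserving

/-- The fundamental domain consists of `2 ^ k` unit cubes. -/
theorem Colouring.volume_eq (c : Colouring W) : c.volume = 2 ^ Module.finrank (ZMod 2) W := by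
  rw [Colouring.volume, c.isFundamentalDomain.covolume_eq_volume, c.volume_domain]

/-! ### Lifting maps to the universal cover -/

/-- Two simply connected covering spaces of the same space are isomorphic. -/
theorem exists_homeomorph_lift {E E' X : Type*} [TopologicalSpace E] [TopologicalSpace E']
    [TopologicalSpace X] [SimplyConnectedSpace E] [LocallyPathConnectedSpace E]
    [SimplyConnectedSpace E'] [LocallyPathConnectedSpace E'] {p : E → X} {p' : E' → X}
    (hp : IsCoveringMap p) (hp' : IsCoveringMap p') (hs : Function.Surjective p') :
    ∃ F : E ≃ₜ E', ∀ x, p' (F x) = p x := by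
  let a : E := Classical.arbitrary E
  obtain ⟨b, hb⟩ := hs (p a)
  obtain ⟨F, ⟨hF1, hF2⟩, -⟩ :=
    hp'.existsUnique_continuousMap_lifts ⟨p, hp.continuous⟩ a b hb
  obtain ⟨G, ⟨hG1, hG2⟩, -⟩ :=
    hp.existsUnique_continuousMap_lifts ⟨p', hp'.continuous⟩ b a hb.symm
  replace hF2 : ∀ x, p' (F x) = p x := congrFun hF2
  replace hG2 : ∀ x, p (G x) = p' x := congrFun hG2
  have h1 : G ∘ F = id := hp.eq_of_comp_eq (by fun_prop) continuous_id
    (funext fun x => by simp [hF2, hG2]) a (by simp [hF1, hG1])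
  have h2 : F ∘ G = id := hp'.eq_of_comp_eq (by fun_prop) continuous_id
    (funext fun x => by simp [hF2, hG2]) b (by simp [hF1, hG1])
  exact ⟨⟨⟨F, G, congrFun h1, congrFun h2⟩, F.continuous, G.continuous⟩, hF2⟩

/-- The projection to the manifold of a colouring. -/
abbrev Colouring.proj (c : Colouring W) (x : Space) : c.Manifold :=
  Quotient.mk (MulAction.orbitRel c.kernelGroup Space) x

theorem Colouring.proj_eq_iff {c : Colouring W} {x y : Space} :
    c.proj x = c.proj y ↔ ∃ g ∈ c.kernelGroup, g y = x := by
  rw [Quotient.eq]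
  change x ∈ MulAction.orbit _ y ↔ _
  constructor
  · rintro ⟨g, rfl⟩
    exact ⟨g.1, g.2, rfl⟩
  · rintro ⟨g, hg, rfl⟩
    exact ⟨⟨g, hg⟩, rfl⟩

theorem Colouring.eq_one_of_dist_lt {c : Colouring W} {g : Space ≃ᵃⁱ[ℝ] Space}
    (hg : g ∈ c.kernelGroup) {x : Space} (h : dist (g x) x < 2) : g = 1 := by
  by_contra h1
  exact absurd (c.two_le_dist hg h1 x) (not_le.2 h)

theorem Colouring.isQuotientCoveringMap (c : Colouring W) :
    IsQuotientCoveringMap c.proj c.kernelGroup where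
  toIsQuotientMap := isQuotientMap_quot_mk
  continuous_const_smul g := g.1.continuous
  apply_eq_iff_mem_orbit := Quotient.eq
  disjoint x := by
    refine ⟨Metric.ball x 1, Metric.ball_mem_nhds x one_pos, fun g => ?_⟩
    rintro ⟨_, ⟨y, hy, rfl⟩, hgy⟩
    refine Subtype.ext (c.eq_one_of_dist_lt g.2 (x := y) ?_)
    have := dist_triangle_right (g.1 y) y x
    rw [Metric.mem_ball] at hy hgy
    change dist (g.1 y) x < 1 at hgy
    linarith

/-- A homeomorphism between the manifolds lifts to the universal covers. -/
theorem Colouring.exists_lift {c : Colouring W} {c' : Colouring W'}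
    (e : c.Manifold ≃ₜ c'.Manifold) : ∃ F : Space ≃ₜ Space, ∀ x, c'.proj (F x) = e (c.proj x) :=
  exists_homeomorph_lift (c.isQuotientCoveringMap.homeomorph_comp e).isCoveringMap
    c'.isQuotientCoveringMap.isCoveringMap Quotient.mk_surjective

/-- The lift of a homeomorphism normalizes the groups of deck transformations. -/
theorem Colouring.exists_conj {c : Colouring W} {c' : Colouring W'}
    {e : c.Manifold ≃ₜ c'.Manifold} {F : Space ≃ₜ Space} (hF : ∀ x, c'.proj (F x) = e (c.proj x))
    {g : Space ≃ᵃⁱ[ℝ] Space} (hg : g ∈ c.kernelGroup) :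
    ∃ g' ∈ c'.kernelGroup, ∀ x, F (g x) = g' (F x) := by
  have hfix : ∀ x, c.proj (g x) = c.proj x := fun x => Colouring.proj_eq_iff.2 ⟨g, hg, rfl⟩
  obtain ⟨g', hg', h0⟩ := Colouring.proj_eq_iff.1
    (show c'.proj (F (g 0)) = c'.proj (F 0) by rw [hF, hF, hfix])
  refine ⟨g', hg', congrFun (c'.isQuotientCoveringMap.isCoveringMap.eq_of_comp_eq
    (g₁ := F ∘ g) (g₂ := g' ∘ F) (F.continuous.comp g.continuous)
    (g'.continuous.comp F.continuous) (funext fun x => ?_) 0 h0.symm)⟩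
  have h1 : c'.proj (g' (F x)) = c'.proj (F x) := Colouring.proj_eq_iff.2 ⟨g', hg', rfl⟩
  change c'.proj (F (g x)) = c'.proj (g' (F x))
  rw [h1, hF, hF, hfix]

theorem Colouring.Homeomorphic.symm {c : Colouring W} {c' : Colouring W'} (h : c.Homeomorphic c') :
    c'.Homeomorphic c :=
  ⟨h.some.symm⟩

/-- Whether `ker λ` is commutative depends only on the topology of the manifold, since `ker λ` is
the group of deck transformations of its universal cover. -/
theorem Colouring.Homeomorphic.commute {c : Colouring W} {c' : Colouring W'}
    (h : c.Homeomorphic c')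
    (hc : ∀ g ∈ c'.kernelGroup, ∀ h ∈ c'.kernelGroup, g * h = h * g) :
    ∀ g ∈ c.kernelGroup, ∀ h ∈ c.kernelGroup, g * h = h * g := by
  obtain ⟨e⟩ := h
  obtain ⟨F, hF⟩ := Colouring.exists_lift e
  intro g hg h hh
  obtain ⟨g', hg', h1⟩ := Colouring.exists_conj hF hg
  obtain ⟨h', hh', h2⟩ := Colouring.exists_conj hF hh
  refine AffineIsometryEquiv.ext fun x => F.injective ?_
  change F (g (h x)) = F (h (g x))
  rw [h1, h2, h2, h1]
  exact congrArg (fun k : Space ≃ᵃⁱ[ℝ] Space => k (F x)) (hc g' hg' h' hh')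

/-! ### Isometries between the manifolds -/

theorem Colouring.quotientDist_lt_iff {c : Colouring W} {x y : Space} {r : ℝ} :
    c.quotientDist (c.proj x) (c.proj y) < r ↔ ∃ g ∈ c.kernelGroup, dist x (g y) < r := by
  rw [Colouring.quotientDist, csInf_lt_iff]
  · constructor
    · rintro ⟨_, ⟨x', y', hx, hy, rfl⟩, h⟩
      obtain ⟨g, hg, rfl⟩ := Colouring.proj_eq_iff.1 hx
      obtain ⟨k, hk, rfl⟩ := Colouring.proj_eq_iff.1 hy
      refine ⟨g⁻¹ * k, mul_mem (inv_mem hg) hk, ?_⟩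
      rw [← g.dist_map]
      change dist (g x) (g (g.symm (k y))) < r
      rwa [g.apply_symm_apply]
    · rintro ⟨g, hg, h⟩
      exact ⟨_, ⟨x, g y, rfl, Colouring.proj_eq_iff.2 ⟨g, hg, rfl⟩, rfl⟩, h⟩
  · refine ⟨0, ?_⟩
    rintro _ ⟨x', y', -, -, rfl⟩
    exact dist_nonneg
  · exact ⟨_, x, y, rfl, rfl, rfl⟩

/-- The projection to the manifold preserves distances less than `1`, since elements of `ker λ`
displace points by at least `2`. -/
theorem Colouring.quotientDist_eq {c : Colouring W} {x y : Space} (h : dist x y < 1) :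
    c.quotientDist (c.proj x) (c.proj y) = dist x y := by
  refine le_antisymm (le_of_forall_gt fun r hr => ?_) (not_lt.1 fun hlt => ?_)
  · exact Colouring.quotientDist_lt_iff.2 ⟨1, one_mem _, hr⟩
  · obtain ⟨g, hg, hlt⟩ := Colouring.quotientDist_lt_iff.1 hlt
    have h2 : dist (g y) y < 2 := by
      have := dist_triangle_left (g y) y x
      linarith
    obtain rfl := c.eq_one_of_dist_lt hg h2
    exact lt_irrefl _ hlt

/-- The metric `quotientDist` induces the quotient topology, so that maps which preserve it are
continuous. -/
theorem Colouring.continuous_of_quotientDist {c : Colouring W} {c' : Colouring W'}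
    {e : c.Manifold → c'.Manifold}
    (he : ∀ p q, c'.quotientDist (e p) (e q) = c.quotientDist p q) : Continuous e := by
  rw [c.isQuotientCoveringMap.toIsQuotientMap.continuous_iff, continuous_def]
  intro U hU
  rw [Metric.isOpen_iff]
  intro x hx
  obtain ⟨y, hy : c'.proj y = _⟩ := Quotient.mk_surjective (e (c.proj x))
  have hU' : IsOpen (c'.proj ⁻¹' U) := hU.preimage c'.isQuotientCoveringMap.continuous
  have hyU : c'.proj y ∈ U := by
    rw [hy]
    exact hx
  obtain ⟨r, hr, hball⟩ := Metric.isOpen_iff.1 hU' y hyU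
  refine ⟨r, hr, fun z hz => ?_⟩
  obtain ⟨t, ht : c'.proj t = _⟩ := Quotient.mk_surjective (e (c.proj z))
  have h1 : c.quotientDist (c.proj x) (c.proj z) < r :=
    Colouring.quotientDist_lt_iff.2 ⟨1, one_mem _, by rwa [Metric.mem_ball'] at hz⟩
  rw [← he, ← hy, ← ht] at h1
  obtain ⟨g, hg, h2⟩ := Colouring.quotientDist_lt_iff.1 h1
  have h3 : c'.proj (g t) ∈ U := hball (by rwa [Metric.mem_ball'])
  rw [show c'.proj (g t) = c'.proj t from Colouring.proj_eq_iff.2 ⟨g, hg, rfl⟩] at h3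
  change e (c.proj z) ∈ U
  rw [← ht]
  exact h3

/-- A map that preserves the distances locally from each point does not increase distances: this
holds along segments, by continuous induction. -/
theorem dist_le_of_eventually_dist_eq {E E' : Type*} [NormedAddCommGroup E] [NormedSpace ℝ E]
    [PseudoMetricSpace E'] {F : E → E'} (hF : Continuous F)
    (h : ∀ x, ∀ᶠ y in 𝓝 x, dist (F x) (F y) = dist x y) (x y : E) :
    dist (F x) (F y) ≤ dist x y := by
  let γ : ℝ → E := AffineMap.lineMap x y
  have hγ : Continuous γ := AffineMap.lineMap_continuous
  have hsub : Set.Icc (0 : ℝ) 1 ⊆ {t : ℝ | dist (F x) (F (γ t)) ≤ t * dist x y} := by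
    refine IsClosed.Icc_subset_of_forall_mem_nhdsWithin ?_ ?_ ?_
    · exact (isClosed_le (by fun_prop) (by fun_prop)).inter isClosed_Icc
    · simp [γ]
    · rintro t ⟨ht, -⟩
      have h1 : ∀ᶠ u in 𝓝[>] t, dist (F (γ t)) (F (γ u)) = dist (γ t) (γ u) :=
        (hγ.continuousAt.tendsto.mono_left nhdsWithin_le_nhds).eventually (h (γ t))
      filter_upwards [h1, self_mem_nhdsWithin] with u hu htu
      have h2 : dist (γ t) (γ u) = (u - t) * dist x y := by
        rw [dist_lineMap_lineMap, Real.dist_eq, abs_sub_comm, abs_of_pos (sub_pos.2 htu)]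
      have := dist_triangle (F x) (F (γ t)) (F (γ u))
      change dist (F x) (F (γ t)) ≤ t * dist x y at ht
      change dist (F x) (F (γ u)) ≤ u * dist x y
      linarith
  simpa [γ] using hsub (Set.right_mem_Icc.2 zero_le_one)

theorem Colouring.dist_lift_le {c : Colouring W} {c' : Colouring W'}
    {e : c.Manifold → c'.Manifold}
    (he : ∀ p q, c'.quotientDist (e p) (e q) = c.quotientDist p q) {F : Space → Space}
    (hFc : Continuous F) (hF : ∀ x, c'.proj (F x) = e (c.proj x)) (x y : Space) :
    dist (F x) (F y) ≤ dist x y := by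
  refine dist_le_of_eventually_dist_eq hFc (fun x => ?_) x y
  have h1 : ∀ᶠ y in 𝓝 x, dist x y < 1 := by
    filter_upwards [Metric.ball_mem_nhds x one_pos] with y hy
    rwa [Metric.mem_ball'] at hy
  have h2 : ∀ᶠ y in 𝓝 x, dist (F x) (F y) < 1 := by
    filter_upwards [hFc.continuousAt (Metric.ball_mem_nhds (F x) one_pos)] with y hy
    change F y ∈ Metric.ball (F x) 1 at hy
    rwa [Metric.mem_ball'] at hy
  filter_upwards [h1, h2] with y h1 h2
  rw [← c.quotientDist_eq h1, ← c'.quotientDist_eq h2, hF, hF, he]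

/-- An isometry between the manifolds lifts to an isometry of space. -/
theorem Colouring.Isometric.exists_affineIsometryEquiv {c : Colouring W} {c' : Colouring W'}
    (h : c.Isometric c') : c.Homeomorphic c' ∧ ∃ Φ : Space ≃ᵃⁱ[ℝ] Space,
      ∀ g, g ∈ c.kernelGroup ↔ Φ * g * Φ⁻¹ ∈ c'.kernelGroup := by
  obtain ⟨e, he⟩ := h
  have he' : ∀ p q, c.quotientDist (e.symm p) (e.symm q) = c'.quotientDist p q := fun p q => by
    rw [← he, e.apply_symm_apply, e.apply_symm_apply]
  let e' : c.Manifold ≃ₜ c'.Manifold :=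
    ⟨e, Colouring.continuous_of_quotientDist he, Colouring.continuous_of_quotientDist he'⟩
  refine ⟨⟨e'⟩, ?_⟩
  obtain ⟨F, hF⟩ := Colouring.exists_lift e'
  have hF' : ∀ x, c.proj (F.symm x) = e'.symm (c'.proj x) := fun x => by
    rw [Homeomorph.eq_symm_apply, ← hF, F.apply_symm_apply]
  have hiso : Isometry F := by
    refine Isometry.of_dist_eq fun x y =>
      le_antisymm (Colouring.dist_lift_le he F.continuous hF x y) ?_
    have := Colouring.dist_lift_le he' F.symm.continuous hF' (F x) (F y)
    simpa using this
  let Φ : Space ≃ᵃⁱ[ℝ] Space :=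
    IsometryEquiv.toRealAffineIsometryEquiv ⟨F.toEquiv, hiso⟩
  have hΦ : ∀ x, Φ x = F x := fun x => rfl
  have hΦ' : ∀ x, Φ⁻¹ x = F.symm x := fun x => by
    change Φ.symm x = _
    rw [AffineIsometryEquiv.symm_apply_eq, hΦ, F.apply_symm_apply]
  refine ⟨Φ, fun g => ⟨fun hg => ?_, fun hg => ?_⟩⟩
  · obtain ⟨g', hg', h⟩ := Colouring.exists_conj hF hg
    convert hg'
    refine AffineIsometryEquiv.ext fun x => ?_
    change Φ (g (Φ⁻¹ x)) = g' x
    rw [hΦ, h, hΦ', F.apply_symm_apply]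
  · obtain ⟨g', hg', h⟩ := Colouring.exists_conj hF' hg
    convert hg'
    refine AffineIsometryEquiv.ext fun x => ?_
    have := h (F x)
    rw [F.symm_apply_apply] at this
    rw [← this, ← hΦ', ← hΦ]
    change _ = (Φ⁻¹ * (Φ * g * Φ⁻¹ * Φ)) x
    congr 1
    group

theorem constVAdd_conj (Φ : Space ≃ᵃⁱ[ℝ] Space) (v : Space) :
    Φ * AffineIsometryEquiv.constVAdd ℝ Space v * Φ⁻¹ =
      AffineIsometryEquiv.constVAdd ℝ Space (Φ.linearIsometryEquiv v) := by
  rw [mul_inv_eq_iff_eq_mul]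
  refine AffineIsometryEquiv.ext fun x => ?_
  change Φ (v +ᵥ x) = Φ.linearIsometryEquiv v +ᵥ Φ x
  exact Φ.map_vadd x v

theorem Colouring.lengthSpectrum_eq_of_conj {c : Colouring W} {c' : Colouring W'}
    {Φ : Space ≃ᵃⁱ[ℝ] Space} (h : ∀ g, g ∈ c.kernelGroup ↔ Φ * g * Φ⁻¹ ∈ c'.kernelGroup) :
    c.lengthSpectrum = c'.lengthSpectrum := by
  have hL : ∀ v, v ∈ c.toricLattice ↔ Φ.linearIsometryEquiv v ∈ c'.toricLattice := fun v => by
    change AffineIsometryEquiv.constVAdd ℝ Space v ∈ c.kernelGroup ↔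
      AffineIsometryEquiv.constVAdd ℝ Space _ ∈ c'.kernelGroup
    rw [h, constVAdd_conj]
  ext l
  constructor
  · rintro ⟨v, hv, h0, rfl⟩
    exact ⟨Φ.linearIsometryEquiv v, (hL v).1 hv, by simpa using h0, by simp⟩
  · rintro ⟨v, hv, h0, rfl⟩
    obtain ⟨v, rfl⟩ := Φ.linearIsometryEquiv.surjective v
    exact ⟨v, (hL v).2 hv, by simpa using h0, by simp⟩

theorem Colouring.volume_eq_of_conj {c : Colouring W} {c' : Colouring W'}
    {Φ : Space ≃ᵃⁱ[ℝ] Space} (h : ∀ g, g ∈ c.kernelGroup ↔ Φ * g * Φ⁻¹ ∈ c'.kernelGroup) :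
    c.volume = c'.volume := by
  let E : c.kernelGroup ≃ c'.kernelGroup :=
    (MulAut.conj Φ).toEquiv.subtypeEquiv h
  have hd := c.isFundamentalDomain.image_of_equiv Φ.toEquiv
    (measurePreserving_affineIsometryEquiv Φ.symm).quasiMeasurePreserving E.symm fun g x => by
      obtain ⟨g, rfl⟩ := E.surjective g
      rw [E.symm_apply_apply]
      change Φ (g.1 x) = (Φ * g.1 * Φ⁻¹ * Φ) x
      rw [inv_mul_cancel_right]
      rfl
  rw [Colouring.volume, Colouring.volume, hd.covolume_eq_volume,
    c.isFundamentalDomain.covolume_eq_volume]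
  exact (volume_image Φ c.measurableSet_domain).symm

/-- DJ-equivalent colourings have conjugate groups. -/
theorem Colouring.mem_kernelGroup_of_djEquiv {c : Colouring W} {c' : Colouring W'}
    {s : Equiv.Perm Facet} (hs : PreservesParallel s) {m : W' →ₗ[ZMod 2] W}
    (hm : Function.Injective m) (h : ∀ f, c.colour f = m (c'.colour (s f)))
    {g : Space ≃ᵃⁱ[ℝ] Space} (hg : g ∈ c.kernelGroup) :
    symmetryIsometry s hs * g * (symmetryIsometry s hs)⁻¹ ∈ c'.kernelGroup := by
  obtain ⟨w, hw, rfl⟩ := hg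
  have key : ∀ w : CoxeterGroup, ∃ w' : CoxeterGroup,
      symmetryIsometry s hs * geometricRep w * (symmetryIsometry s hs)⁻¹ = geometricRep w' ∧
      (c.hom w).toAdd = m (c'.hom w').toAdd := by
    intro w
    induction w using coxeterMatrix.toCoxeterSystem.simple_induction_left with
    | one => exact ⟨1, by simp⟩
    | mul_simple_left w f ih =>
      obtain ⟨w', h1, h2⟩ := ih
      refine ⟨coxeterMatrix.simple (s f) * w', ?_, ?_⟩
      · rw [CoxeterMatrix.toCoxeterSystem_simple, map_mul, map_mul, ← h1, geometricRep_simple,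
          geometricRep_simple, ← mul_assoc, ← mul_assoc, ← mul_assoc]
        congr 2
        exact AffineIsometryEquiv.ext (symmetryIsometry_reflection hs f)
      · rw [CoxeterMatrix.toCoxeterSystem_simple, map_mul c.hom, map_mul c'.hom,
          Colouring.hom_simple, Colouring.hom_simple, toAdd_mul, toAdd_mul, map_add, h2]
        congr 1
        exact h f
  obtain ⟨w', h1, h2⟩ := key w
  refine ⟨w', ?_, h1.symm⟩
  change c'.hom w' = 1
  rw [← toAdd_eq_zero]
  refine hm ?_
  rw [← h2, show c.hom w = 1 from hw, toAdd_one, map_zero]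

/-- An isometry of space that conjugates the groups descends to the manifolds. -/
theorem Colouring.isometric_of_conj {c : Colouring W} {c' : Colouring W'}
    {Φ : Space ≃ᵃⁱ[ℝ] Space} (h : ∀ g, g ∈ c.kernelGroup ↔ Φ * g * Φ⁻¹ ∈ c'.kernelGroup) :
    c.Isometric c' := by
  have hconj : ∀ g x, (Φ * g * Φ⁻¹) (Φ x) = Φ (g x) := fun g x => by
    change (Φ * g * Φ⁻¹ * Φ) x = _
    rw [inv_mul_cancel_right]
    rfl
  have hsurj : ∀ g' : Space ≃ᵃⁱ[ℝ] Space, ∃ g, Φ * g * Φ⁻¹ = g' := (MulAut.conj Φ).surjective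
  refine ⟨Quotient.congr Φ.toEquiv fun x y => ?_, ?_⟩
  · rw [← Quotient.eq, ← Quotient.eq]
    refine Colouring.proj_eq_iff.trans (Iff.trans ?_ Colouring.proj_eq_iff.symm)
    constructor
    · rintro ⟨g, hg, rfl⟩
      exact ⟨_, (h g).1 hg, hconj g y⟩
    · rintro ⟨g', hg', hxy⟩
      obtain ⟨g, rfl⟩ := hsurj g'
      exact ⟨g, (h g).2 hg', Φ.injective ((hconj g y).symm.trans hxy)⟩
  · intro p q
    obtain ⟨x, rfl⟩ := Quotient.mk_surjective p
    obtain ⟨y, rfl⟩ := Quotient.mk_surjective q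
    refine eq_of_forall_gt_iff fun r => ?_
    refine Iff.trans (Colouring.quotientDist_lt_iff (c := c') (x := Φ x) (y := Φ y))
      (Iff.trans ?_ Colouring.quotientDist_lt_iff.symm)
    constructor
    · rintro ⟨g', hg', hd⟩
      obtain ⟨g, rfl⟩ := hsurj g'
      refine ⟨g, (h g).2 hg', ?_⟩
      rwa [hconj, Φ.dist_map] at hd
    · rintro ⟨g, hg, hd⟩
      refine ⟨_, (h g).1 hg, ?_⟩
      rwa [hconj, Φ.dist_map]

theorem Colouring.DJEquiv.isometric {c : Colouring W} {c' : Colouring W'} (h : c.DJEquiv c') :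
    c.Isometric c' := by
  obtain ⟨s, hs, m, h⟩ := h
  have hs := hs.preservesParallel
  refine Colouring.isometric_of_conj (Φ := symmetryIsometry s hs) fun g =>
    ⟨Colouring.mem_kernelGroup_of_djEquiv hs (m := m.toLinearMap) m.injective h, fun hg => ?_⟩
  have := Colouring.mem_kernelGroup_of_djEquiv (c := c') (c' := c) hs.symm
    (m := m.symm.toLinearMap) m.symm.injective (fun f => by simp [h]) hg
  have hinv : symmetryIsometry s.symm hs.symm = (symmetryIsometry s hs)⁻¹ := by
    rw [← mul_eq_one_iff_eq_inv]
    refine AffineIsometryEquiv.ext fun x => depth_ext fun f => ?_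
    change depth (symmetryIsometry s.symm hs.symm (symmetryIsometry s hs x)) f = depth x f
    simp [depth_symmetryIsometry]
  rw [hinv] at this
  convert this using 1
  group

/-! ### The classification -/

/-- The order of the code is given by the volume, the weights of its translational vectors by the
lengths `2`, `2 √2` and `2 √3`, and the commutativity of the fundamental group tells whether all of
its vectors are translational. -/
theorem Colouring.djEquiv_of_invariants {c : Colouring W} {c' : Colouring W'}
    (hc : c.Orientable) (hc' : c'.Orientable) (hh : c.Homeomorphic c')
    (hv : c.volume = c'.volume) (hl : c.lengthSpectrum = c'.lengthSpectrum) : c.DJEquiv c' := by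
  have := c.finite
  have := c'.finite
  rw [Colouring.djEquiv_iff]
  refine codeEquiv_of_invariants c.isProperCode (c.orientable_iff.1 hc) c'.isProperCode
    (c'.orientable_iff.1 hc') ?_ (fun w hw => ?_) ?_
  · have hk : Module.finrank (ZMod 2) W = Module.finrank (ZMod 2) W' := by
      rw [c.volume_eq, c'.volume_eq] at hv
      exact Nat.pow_right_injective le_rfl (by exact_mod_cast hv)
    have h1 := c.card_code
    rw [← c'.card_code, hk] at h1
    exact Nat.eq_of_mul_eq_mul_right (by positivity) h1
  · rw [← Colouring.mem_lengthSpectrum_iff hw, ← Colouring.mem_lengthSpectrum_iff hw, hl]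
  · rw [← c.commute_iff, ← c'.commute_iff]
    exact ⟨hh.symm.commute, hh.commute⟩

/-- An isometry of the manifolds lifts to space, hence it preserves all of the invariants. -/
theorem Colouring.isometric_iff_djEquiv {c : Colouring W} {c' : Colouring W'}
    (hc : c.Orientable) (hc' : c'.Orientable) : c.Isometric c' ↔ c.DJEquiv c' := by
  refine ⟨fun h => ?_, Colouring.DJEquiv.isometric⟩
  obtain ⟨hh, Φ, hΦ⟩ := h.exists_affineIsometryEquiv
  exact Colouring.djEquiv_of_invariants hc hc' hh (Colouring.volume_eq_of_conj hΦ)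
    (Colouring.lengthSpectrum_eq_of_conj hΦ)

theorem Colouring.exists_normalForm {c : Colouring W} (hc : c.Orientable) :
    ∃ L : {L // L ∈ normalForms}, CodeEquiv c.code (normalCode L) ∧
      L.1.length * 2 ^ Module.finrank (ZMod 2) W = 64 := by
  have := c.finite
  obtain ⟨L, hL⟩ := exists_codeEquiv_normalCode c.isProperCode (c.orientable_iff.1 hc)
  exact ⟨L, hL, by rw [← card_normalCode, ← hL.card_eq, c.card_code]⟩

theorem normalCode_injective {L L' : {L // L ∈ normalForms}}
    (h : CodeEquiv (normalCode L) (normalCode L')) : L = L' := by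
  refine Subtype.ext (normalForms_injective _ L.2 _ L'.2 ?_ (fun w _ => ?_) ?_)
  · rw [← card_normalCode, ← card_normalCode, h.card_eq]
  · simpa [HasWeight, mem_normalCode] using h.hasWeight_iff w
  · simpa [mem_normalCode] using h.translational_iff

variable (W) in
/-- The classes of orientable colourings correspond to the normal forms of suitable order. -/
theorem card_djClass [Module.Finite (ZMod 2) W] : Nat.card (DJClass W) =
    (normalForms.filter fun L => L.length * 2 ^ Module.finrank (ZMod 2) W = 64).length := by
  have hex : ∀ L : {L : {L // L ∈ normalForms} //
      L.1.length * 2 ^ Module.finrank (ZMod 2) W = 64},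
      ∃ c : {c : Colouring W // c.Orientable}, c.1.code = normalCode L.1 := by
    rintro ⟨L, hL⟩
    obtain ⟨c, hc⟩ := exists_colouring_code_eq (W := W) (isProperCode_normalCode L)
      (by rw [card_normalCode, hL])
    exact ⟨⟨c, c.orientable_iff.2 (hc ▸ isEvenCode_normalCode L)⟩, hc⟩
  choose col hcol using hex
  have hbij : Function.Bijective fun L => (Quotient.mk (djSetoid W) (col L) : DJClass W) := by
    constructor
    · intro L L' h
      have h1 : (col L).1.DJEquiv (col L').1 := Quotient.exact h
      rw [Colouring.djEquiv_iff, hcol, hcol] at h1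
      exact Subtype.ext (normalCode_injective h1)
    · intro q
      obtain ⟨c, rfl⟩ := Quotient.mk_surjective q
      obtain ⟨L, hL, hlen⟩ := Colouring.exists_normalForm c.2
      refine ⟨⟨L, hlen⟩, Quotient.sound ?_⟩
      change (col _).1.DJEquiv c.1
      rw [Colouring.djEquiv_iff, hcol]
      exact hL.symm
  have hnd : normalForms.Nodup := by decide
  refine (Nat.card_eq_of_bijective _ hbij).symm.trans ?_
  rw [← List.toFinset_card_of_nodup (hnd.filter _),
    Nat.card_congr (Equiv.subtypeSubtypeEquivSubtypeInter (· ∈ normalForms)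
      fun L => L.length * 2 ^ Module.finrank (ZMod 2) W = 64)]
  exact Nat.subtype_card _ (by simp)

end RightAngledCube

end

theorem mainTheorem4 {W : Type*} [AddCommGroup W] [Module (ZMod 2) W]
    {W' : Type*} [AddCommGroup W'] [Module (ZMod 2) W'] :
    (Module.finrank (ZMod 2) W = 3 → Nat.card (RightAngledCube.DJClass W) = 2) ∧
    (Module.finrank (ZMod 2) W = 4 → Nat.card (RightAngledCube.DJClass W) = 6) ∧
    (Module.finrank (ZMod 2) W = 5 → Nat.card (RightAngledCube.DJClass W) = 4) ∧
    (Module.finrank (ZMod 2) W = 6 → Nat.card (RightAngledCube.DJClass W) = 1) ∧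
    (Module.finrank (ZMod 2) W ∉ Finset.Icc 3 6 → IsEmpty (RightAngledCube.DJClass W)) ∧
    (∀ c : RightAngledCube.Colouring W,
      c.volume = 2 ^ Module.finrank (ZMod 2) W) ∧
    (∀ (c : RightAngledCube.Colouring W) (c' : RightAngledCube.Colouring W'),
      c.Orientable → c'.Orientable →
        (c.Isometric c' ↔ c.DJEquiv c') ∧
        (¬ c.DJEquiv c' →
          ¬ c.Homeomorphic c' ∨ c.volume ≠ c'.volume ∨ c.lengthSpectrum ≠ c'.lengthSpectrum)) := by
  refine ⟨fun h => ?_, fun h => ?_, fun h => ?_, fun h => ?_, fun h => ⟨fun q => ?_⟩,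
    fun c => c.volume_eq, fun c c' hc hc' =>
    ⟨RightAngledCube.Colouring.isometric_iff_djEquiv hc hc', fun hne => ?_⟩⟩
  any_goals
    have : Module.Finite (ZMod 2) W := Module.finite_of_finrank_pos (by omega)
    rw [RightAngledCube.card_djClass W, h]
    decide
  · obtain ⟨c, rfl⟩ := Quotient.mk_surjective q
    obtain ⟨L, -, hL⟩ := RightAngledCube.Colouring.exists_normalForm c.2
    have hlen : ∀ L ∈ RightAngledCube.normalForms, L.length ∈ [1, 2, 4, 8] := by decide
    have h8 := hlen _ L.2
    generalize Module.finrank (ZMod 2) W = k at h hL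
    -- `2 ^ k` divides `64`
    have hk : k < 7 := (Nat.pow_lt_pow_iff_right (a := 2) (by norm_num)).1
      (lt_of_le_of_lt (Nat.le_of_dvd (by norm_num) ⟨_, (mul_comm _ _).trans hL |>.symm⟩)
        (by norm_num))
    simp only [Finset.mem_Icc] at h
    interval_cases k <;> simp at h h8 <;> omega
  · by_contra! h
    obtain ⟨h1, h2, h3⟩ := h
    exact hne (RightAngledCube.Colouring.djEquiv_of_invariants hc hc' h1 h2 h3)
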